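/- Conventions. A linear complex structure on the oriented real plane $\mathbb C$ is a real-linear map $J:\mathbb C\to\mathbb C$ with $J^2=-1$ such that $(v,Jv)$ is positively oriented for all $v\neq 0$; an almost complex structure $\sigma$ on a domain $U\subset\mathbb C$ assigns to each $z\in U$ such a $J_{\sigma(z)}$. Structures on $U$ converge almost everywhere if the corresponding maps $J$ converge at almost every point. The dilatation of a nonzero real-linear map $A:\mathbb C\to\mathbb C$ is $\max_{|v|=1}|Av|/\min_{|v|=1}|Av|\in[1,\infty]$. A map $\Phi$ on $U$ has local $L^2$ derivatives if its distributional derivative $d\Phi$ on $U$ is given by a field of real-linear maps $\mathbb C\to\mathbb C$ that is square integrable on compact subsets of $U$. A homeomorphism $\Phi$ of $U$ onto a domain $\Phi(U)\subset\mathbb C$ is $K$-quasiconformal if it has local $L^2$ derivatives and, for almost every $z\in U$ with $d\Phi(z)\neq0$, the map $d\Phi(z)$ preserves the orientation and has dilatation at most $K$. A homeomorphism $\Phi$ with local $L^2$ derivatives sends $\sigma$ to the standard complex structure if $d\Phi(z)\circ J_{\sigma(z)}=i\,d\Phi(z)$ for almost every $z\in U$ (equivalently $\partial\Phi/\partial\bar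 z=\mu\,\partial\Phi/\partial z$ almost everywhere, where $\mu$, $|\mu|<1$, is the function for which $dz+\mu\,d\bar z$ is $\sigma$-complex-linear). Lemma. Let $K>0$, let $U\subset\mathbb C$ be a domain (possibly the whole of $\mathbb C$), and let $\Phi_n:U\to\Phi_n(U)\subset\mathbb C$ be a sequence of $K$-quasiconformal homeomorphisms converging, uniformly on compact subsets of $U$, to a homeomorphism $\Phi$ of $U$ onto a domain $\Phi(U)\subset\mathbb C$. Let $\sigma_n$ be almost complex structures on $U$ sent to the standard complex structure by $\Phi_n$, and suppose that $\sigma_n$ converge almost everywhere on $U$ to an almost complex structure $\sigma$. Then $\Phi$ is $K$-quasiconformal and sends $\sigma$ to the standard complex structure. -/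

import Mathlib

open MeasureTheory Filter Topology
open scoped ENNReal ContDiff

/-- A linear complex structure on the oriented real plane `ℂ`: multiplication by the imaginary
unit of a structure of complex vector space, i.e. a real-linear `J` with `J² = -1`, which is
compatible with the orientation: `(v, J v)` is a positively oriented basis for every `v ≠ 0`. -/
structure LinearComplexStructure where
  J : ℂ →L[ℝ] ℂ
  sq_eq : ∀ v : ℂ, J (J v) = -v
  oriented : ∀ v : ℂ, v ≠ 0 → 0 < ((starRingEnd ℂ) v * J v).im

/-- An almost complex structure: a linear complex structure on each tangent plane. For a structure
on a domain `U` only the values at the points of `U` matter. -/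
abbrev AlmostComplexStructure : Type := ℂ → LinearComplexStructure

/-- The dilatation of a real-linear map: the ratio of the largest radius over the smallest radius
of the image of the unit circle. It is `∞` for a non-zero map that is not an isomorphism. -/
noncomputable def dilatation (A : ℂ →L[ℝ] ℂ) : ℝ≥0∞ :=
  (⨆ v : Metric.sphere (0 : ℂ) 1, ‖A v‖ₑ) / (⨅ v : Metric.sphere (0 : ℂ) 1, ‖A v‖ₑ)

/-- `G` is the derivative of `Φ` on `U` in the sense of distributions: for every real test function
`φ` with compact support in `U` and every direction `v`, `∫ (∂ᵥ φ) Φ = - ∫ φ (G v)`. -/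
def IsWeakDeriv (U : Set ℂ) (Φ : ℂ → ℂ) (G : ℂ → ℂ →L[ℝ] ℂ) : Prop :=
  ∀ φ : ℂ → ℝ, ContDiff ℝ ∞ φ → HasCompactSupport φ → tsupport φ ⊆ U →
    ∀ v : ℂ, ∫ z, (fderiv ℝ φ z v) • Φ z = -∫ z, φ z • G z v

/-- `Φ` has local `L²` derivatives on `U`, and `G` is its derivative (unique almost everywhere). -/
def HasLocalL2Deriv (U : Set ℂ) (Φ : ℂ → ℂ) (G : ℂ → ℂ →L[ℝ] ℂ) : Prop :=
  (∀ C : Set ℂ, IsCompact C → C ⊆ U → MemLp G 2 (volume.restrict C)) ∧ IsWeakDeriv U Φ G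

/-- `Φ` restricts to a homeomorphism of the open set `U` onto an open set `Φ(U) ⊆ ℂ`. -/
def IsHomeoOnto (U : Set ℂ) (Φ : ℂ → ℂ) : Prop :=
  IsOpenEmbedding (fun z : U => Φ z)

/-- `Φ` is a `K`-quasiconformal homeomorphism of `U` onto `Φ(U)`: a homeomorphism with local `L²`
derivatives which, at almost every point where its derivative is non-zero, preserves the
orientation and has dilatation at most `K`. -/
def IsKHomeo (K : ℝ) (U : Set ℂ) (Φ : ℂ → ℂ) : Prop :=
  IsHomeoOnto U Φ ∧
    ∃ G : ℂ → ℂ →L[ℝ] ℂ, HasLocalL2Deriv U Φ G ∧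
      ∀ᵐ z ∂(volume.restrict U), G z ≠ 0 →
        0 < (G z).det ∧ dilatation (G z) ≤ ENNReal.ofReal K

/-- `Φ` sends the almost complex structure `σ` on `U` to the standard one: at almost every point
of `U` its derivative is complex-linear from `(ℂ, σ z)` to `ℂ` with the standard structure. -/
def SendsToStandard (U : Set ℂ) (Φ : ℂ → ℂ) (σ : AlmostComplexStructure) : Prop :=
  ∃ G : ℂ → ℂ →L[ℝ] ℂ, HasLocalL2Deriv U Φ G ∧
    ∀ᵐ z ∂(volume.restrict U), ∀ v : ℂ, G z ((σ z).J v) = Complex.I * G z v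

/-! Write each derivative as `v ↦ a v + b v̄`. Orientation together with dilatation at most `K`
becomes `|a| + |b| ≤ K (|a| - |b|)`, and sending a structure to the standard one becomes the
Beltrami equation `b = μ a`, with `|μ| < 1` depending continuously on the structure
(`comp_eq_I_mul_iff`, `tendsto_beltrami`).

The dilatation bound gives `|G|² ≤ K det G`. The Jacobian is a null Lagrangian, so its integral
against a cutoff can be integrated by parts. This bounds the energy of `Φ_n` on a compact set by the
supremum of `|Φ_n|` on a slightly larger one (`caccioppoli`, `exists_lintegral_enorm_sq_le`).
Uniform convergence bounds these suprema, so the derivatives are bounded in `L²` on each compact set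
and have weak limits, which by testing form the distributional derivative of `Φ`.

The Beltrami equation is a product and needs more than weak convergence. Since `μ_n` is bounded and
converges almost everywhere, `g μ_n` converges strongly in `L²` for each `g` in `L²`, and strong
times weak passes to the limit (`IsWeakL2Limit.mul`, `IsWeakL2Limit.ae_eq_mul`).

The constant `K` is kept by the same principle. The equation still holds with `μ_n` retracted to the
disk of radius `(K - 1)/(K + 1)`, because it only constrains `μ_n` where `a ≠ 0`. The limit equation
then has a coefficient in that disk. Where the limit derivative is nonzero, `|μ| < 1` makes it
orientation preserving. -/

/-! ### Wirtinger coefficients, determinant and dilatation of real-linear maps -/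

/-- The complex-linear coefficient `a` of a real-linear map `v ↦ a v + b v̄`. -/
noncomputable def wirtinger (A : ℂ →L[ℝ] ℂ) : ℂ := (A 1 - Complex.I * A Complex.I) / 2

/-- The antilinear coefficient `b` of a real-linear map `v ↦ a v + b v̄`. -/
noncomputable def wirtingerBar (A : ℂ →L[ℝ] ℂ) : ℂ := (A 1 + Complex.I * A Complex.I) / 2

/-- The real-linear map `v ↦ a v + b v̄`. -/
noncomputable def ofWirtinger (a b : ℂ) : ℂ →L[ℝ] ℂ :=
  a • ContinuousLinearMap.id ℝ ℂ + b • (Complex.conjCLE : ℂ →L[ℝ] ℂ)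

@[simp]
lemma ofWirtinger_apply (a b v : ℂ) : ofWirtinger a b v = a * v + b * (starRingEnd ℂ) v := by
  simp [ofWirtinger]

lemma apply_eq_wirtinger (A : ℂ →L[ℝ] ℂ) (v : ℂ) :
    A v = wirtinger A * v + wirtingerBar A * (starRingEnd ℂ) v := by
  have h : A v = v.re * A 1 + v.im * A Complex.I := by
    conv_lhs => rw [show v = v.re • (1 : ℂ) + v.im • Complex.I by simp]
    rw [map_add, map_smul, map_smul]; simp
  rw [h, wirtinger, wirtingerBar]
  apply Complex.ext <;> simp <;> ring

@[simp]
lemma ofWirtinger_wirtinger (A : ℂ →L[ℝ] ℂ) : ofWirtinger (wirtinger A) (wirtingerBar A) = A := by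
  ext1 v; rw [apply_eq_wirtinger A v]; simp

@[simp]
lemma wirtinger_ofWirtinger (a b : ℂ) : wirtinger (ofWirtinger a b) = a := by
  simp only [wirtinger, ofWirtinger_apply]
  apply Complex.ext <;> simp <;> ring

@[simp]
lemma wirtingerBar_ofWirtinger (a b : ℂ) : wirtingerBar (ofWirtinger a b) = b := by
  simp only [wirtingerBar, ofWirtinger_apply]
  apply Complex.ext <;> simp <;> ring

@[fun_prop]
lemma continuous_wirtinger : Continuous wirtinger := by
  unfold wirtinger; fun_prop

@[fun_prop]
lemma continuous_wirtingerBar : Continuous wirtingerBar := by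
  unfold wirtingerBar; fun_prop

lemma norm_wirtinger_le (A : ℂ →L[ℝ] ℂ) : ‖wirtinger A‖ ≤ ‖A‖ := by
  have h1 := A.le_opNorm 1
  have h2 := A.le_opNorm Complex.I
  rw [wirtinger, norm_div]
  have := norm_sub_le (A 1) (Complex.I * A Complex.I)
  simp at *
  linarith

lemma norm_wirtingerBar_le (A : ℂ →L[ℝ] ℂ) : ‖wirtingerBar A‖ ≤ ‖A‖ := by
  have h1 := A.le_opNorm 1
  have h2 := A.le_opNorm Complex.I
  rw [wirtingerBar, norm_div]
  have := norm_add_le (A 1) (Complex.I * A Complex.I)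
  simp at *
  linarith

lemma norm_le_wirtinger (A : ℂ →L[ℝ] ℂ) : ‖A‖ ≤ ‖wirtinger A‖ + ‖wirtingerBar A‖ := by
  refine A.opNorm_le_bound (by positivity) fun v => ?_
  rw [apply_eq_wirtinger A v]
  refine (norm_add_le _ _).trans ?_
  simp [add_mul]

lemma det_eq_re_im (A : ℂ →L[ℝ] ℂ) :
    A.det = (A 1).re * (A Complex.I).im - (A 1).im * (A Complex.I).re := by
  rw [ContinuousLinearMap.det, ← LinearMap.det_toMatrix Complex.basisOneI, Matrix.det_fin_two]
  simp [LinearMap.toMatrix_apply, Complex.basisOneI]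
  ring

lemma det_eq_wirtinger (A : ℂ →L[ℝ] ℂ) :
    A.det = ‖wirtinger A‖ ^ 2 - ‖wirtingerBar A‖ ^ 2 := by
  rw [det_eq_re_im, ← Complex.normSq_eq_norm_sq, ← Complex.normSq_eq_norm_sq]
  simp [wirtinger, wirtingerBar, Complex.normSq_apply]
  ring

/-- The angle of `c` is half the difference of the arguments of `b` and `a`; both products then have
the mean of the two arguments as their phase. -/
lemma exists_align_phases (a b : ℂ) : ∃ c p : ℂ, ‖c‖ = 1 ∧ ‖p‖ = 1 ∧
    a * c = ‖a‖ * p ∧ b * (starRingEnd ℂ) c = ‖b‖ * p := by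
  refine ⟨Complex.exp (((b.arg - a.arg) / 2 : ℝ) * Complex.I),
    Complex.exp (((b.arg + a.arg) / 2 : ℝ) * Complex.I), Complex.norm_exp_ofReal_mul_I _,
    Complex.norm_exp_ofReal_mul_I _, ?_, ?_⟩
  · have h := Complex.norm_mul_exp_arg_mul_I a
    generalize a.arg = θ at *
    rw [← h, mul_assoc, ← Complex.exp_add, norm_mul, Complex.norm_exp_ofReal_mul_I]
    simp only [Complex.norm_real, norm_norm, mul_one]
    congr 2; push_cast; ring
  · have h := Complex.norm_mul_exp_arg_mul_I b
    generalize b.arg = θ at *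
    rw [← Complex.exp_conj, map_mul, Complex.conj_ofReal, Complex.conj_I, ← h, mul_assoc,
      ← Complex.exp_add, norm_mul, Complex.norm_exp_ofReal_mul_I]
    simp only [Complex.norm_real, norm_norm, mul_one]
    congr 2; push_cast; ring

lemma exists_norm_apply_eq_add (A : ℂ →L[ℝ] ℂ) :
    ∃ v : Metric.sphere (0 : ℂ) 1, ‖A v‖ = ‖wirtinger A‖ + ‖wirtingerBar A‖ := by
  obtain ⟨c, p, hc, hp, h1, h2⟩ := exists_align_phases (wirtinger A) (wirtingerBar A)
  refine ⟨⟨c, by simpa using hc⟩, ?_⟩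
  rw [apply_eq_wirtinger A, h1, h2, ← add_mul, norm_mul, hp, mul_one, ← Complex.ofReal_add,
    Complex.norm_real, Real.norm_of_nonneg (by positivity)]

lemma exists_norm_apply_eq_sub (A : ℂ →L[ℝ] ℂ) :
    ∃ v : Metric.sphere (0 : ℂ) 1, ‖A v‖ = |‖wirtinger A‖ - ‖wirtingerBar A‖| := by
  obtain ⟨c, p, hc, hp, h1, h2⟩ := exists_align_phases (wirtinger A) (wirtingerBar A)
  -- A quarter turn from the aligned direction multiplies the two terms by `i` and `-i`, so that
  -- they oppose each other.
  refine ⟨⟨c * Complex.I, by simpa using hc⟩, ?_⟩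
  rw [apply_eq_wirtinger A, map_mul, ← mul_assoc, ← mul_assoc, h1, h2, Complex.conj_I, mul_neg,
    ← sub_eq_add_neg, ← sub_mul, ← sub_mul, norm_mul, norm_mul, hp, ← Complex.ofReal_sub,
    Complex.norm_real]
  simp

/-- The extreme values of `|A v|` on the unit circle are `|a| + |b|` and `||a| - |b||`, and a
positive determinant fixes the sign of the latter. The division-free form also covers `A = 0`. -/
lemma add_le_mul_sub_of_dilatation_le {A : ℂ →L[ℝ] ℂ} {K : ℝ} (hK : 0 < K)
    (h : A ≠ 0 → 0 < A.det ∧ dilatation A ≤ ENNReal.ofReal K) :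
    ‖wirtinger A‖ + ‖wirtingerBar A‖ ≤ K * (‖wirtinger A‖ - ‖wirtingerBar A‖) := by
  by_cases hA : A = 0
  · subst hA; simp [wirtinger, wirtingerBar]
  obtain ⟨hd, hK'⟩ := h hA
  rw [det_eq_wirtinger] at hd
  have hlt : ‖wirtingerBar A‖ < ‖wirtinger A‖ := by
    refine lt_of_pow_lt_pow_left₀ 2 (norm_nonneg _) (by linarith)
  obtain ⟨v, hv⟩ := exists_norm_apply_eq_add A
  obtain ⟨w, hw⟩ := exists_norm_apply_eq_sub A
  rw [abs_of_pos (by linarith)] at hw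
  have h1 : ‖A v‖ₑ / ‖A w‖ₑ ≤ ENNReal.ofReal K :=
    (ENNReal.div_le_div (le_iSup (fun v : Metric.sphere (0 : ℂ) 1 => ‖A v‖ₑ) v)
      (iInf_le (fun v : Metric.sphere (0 : ℂ) 1 => ‖A v‖ₑ) w)).trans hK'
  rw [ENNReal.div_le_iff_le_mul (by left; rw [← ofReal_norm, hw]; simpa using hlt)
    (by simp), ← ofReal_norm, ← ofReal_norm,
    ← ENNReal.ofReal_mul hK.le, hv, hw,
    ENNReal.ofReal_le_ofReal_iff (mul_nonneg hK.le (by linarith))] at h1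
  exact h1

lemma det_pos_and_dilatation_le {A : ℂ →L[ℝ] ℂ} {K : ℝ}
    (hlt : ‖wirtingerBar A‖ < ‖wirtinger A‖)
    (h : ‖wirtinger A‖ + ‖wirtingerBar A‖ ≤ K * (‖wirtinger A‖ - ‖wirtingerBar A‖)) :
    0 < A.det ∧ dilatation A ≤ ENNReal.ofReal K := by
  have hb := norm_nonneg (wirtingerBar A)
  refine ⟨by rw [det_eq_wirtinger]; nlinarith, ?_⟩
  have hK : 0 < K := by
    by_contra! hK
    nlinarith
  have h0 : ENNReal.ofReal (‖wirtinger A‖ - ‖wirtingerBar A‖) ≠ 0 := by simpa using hlt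
  refine ENNReal.div_le_of_le_mul ?_
  calc (⨆ v : Metric.sphere (0 : ℂ) 1, ‖A v‖ₑ)
      ≤ ENNReal.ofReal (‖wirtinger A‖ + ‖wirtingerBar A‖) := by
        refine iSup_le fun v => ?_
        rw [← ofReal_norm]
        refine ENNReal.ofReal_le_ofReal ?_
        rw [apply_eq_wirtinger A v]
        refine (norm_add_le _ _).trans ?_
        simp
    _ ≤ ENNReal.ofReal K * ENNReal.ofReal (‖wirtinger A‖ - ‖wirtingerBar A‖) := by
        rw [← ENNReal.ofReal_mul hK.le]
        exact ENNReal.ofReal_le_ofReal h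
    _ ≤ _ := by
        gcongr
        refine le_iInf fun v => ?_
        rw [← ofReal_norm]
        refine ENNReal.ofReal_le_ofReal ?_
        rw [apply_eq_wirtinger A v]
        have := norm_sub_le_norm_add (wirtinger A * (v : ℂ))
          (wirtingerBar A * (starRingEnd ℂ) (v : ℂ))
        simpa using this

/-- The determinant factors as `(|a| - |b|)(|a| + |b|)`, while the operator norm is at most `|a| +
|b|`. -/
lemma sq_norm_le_mul_det {A : ℂ →L[ℝ] ℂ} {K : ℝ}
    (h : ‖wirtinger A‖ + ‖wirtingerBar A‖ ≤ K * (‖wirtinger A‖ - ‖wirtingerBar A‖)) :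
    ‖A‖ ^ 2 ≤ K * A.det := by
  rw [det_eq_wirtinger]
  calc ‖A‖ ^ 2 ≤ (‖wirtinger A‖ + ‖wirtingerBar A‖) ^ 2 := by gcongr; exact norm_le_wirtinger A
    _ = (‖wirtinger A‖ + ‖wirtingerBar A‖) * (‖wirtinger A‖ + ‖wirtingerBar A‖) := by ring
    _ ≤ (K * (‖wirtinger A‖ - ‖wirtingerBar A‖)) * (‖wirtinger A‖ + ‖wirtingerBar A‖) := by gcongr
    _ = _ := by ring

/-! ### The Beltrami coefficient of a linear complex structure -/

/-- The coefficient `μ` for which `dz + μ dz̄` is complex-linear for the structure `J`. -/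
noncomputable def LinearComplexStructure.beltrami (s : LinearComplexStructure) : ℂ :=
  wirtingerBar s.J / (Complex.I - (starRingEnd ℂ) (wirtinger s.J))

namespace LinearComplexStructure

variable (s : LinearComplexStructure)

/-- These are the coefficients of `v` and `v̄` in `J (J v) = -v`, separated by evaluating at `1` and
`i`. -/
lemma wirtinger_sq : wirtinger s.J ^ 2 + ‖wirtingerBar s.J‖ ^ 2 = -1 ∧
    wirtingerBar s.J * (wirtinger s.J + (starRingEnd ℂ) (wirtinger s.J)) = 0 := by
  have h : ∀ v : ℂ, (wirtinger s.J ^ 2 + ‖wirtingerBar s.J‖ ^ 2 + 1) * v +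
      wirtingerBar s.J * (wirtinger s.J + (starRingEnd ℂ) (wirtinger s.J)) *
        (starRingEnd ℂ) v = 0 := by
    intro v
    have := s.sq_eq v
    rw [apply_eq_wirtinger s.J (s.J v), apply_eq_wirtinger s.J v, map_add, map_mul, map_mul,
      Complex.conj_conj] at this
    have h2 := Complex.mul_conj (wirtingerBar s.J)
    rw [Complex.normSq_eq_norm_sq] at h2
    push_cast at h2
    rw [← h2]
    linear_combination this
  have h1 := h 1
  have hI := h Complex.I
  simp only [map_one, mul_one, Complex.conj_I] at h1 hI
  have hI' : (wirtinger s.J ^ 2 + ‖wirtingerBar s.J‖ ^ 2 + 1) -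
      wirtingerBar s.J * (wirtinger s.J + (starRingEnd ℂ) (wirtinger s.J)) = 0 := by
    refine (mul_eq_zero.1 (?_ : _ * Complex.I = 0)).resolve_right Complex.I_ne_zero
    linear_combination hI
  constructor
  · linear_combination (h1 + hI') / 2
  · linear_combination (h1 - hI') / 2

lemma wirtinger_re : (wirtinger s.J).re = 0 := by
  obtain ⟨h1, h2⟩ := s.wirtinger_sq
  rw [Complex.add_conj] at h2
  rcases mul_eq_zero.1 h2 with h | h
  · rw [h] at h1
    have hr := congrArg Complex.re h1
    have hi := congrArg Complex.im h1
    simp [pow_two] at hr hi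
    nlinarith
  · simpa using h

lemma one_le_wirtinger_im : 1 ≤ (wirtinger s.J).im ∧
    (wirtinger s.J).im ^ 2 = 1 + ‖wirtingerBar s.J‖ ^ 2 := by
  obtain ⟨h1, -⟩ := s.wirtinger_sq
  have hr := congrArg Complex.re h1
  have h0 := s.wirtinger_re
  rw [Complex.add_re, ← Complex.ofReal_pow, Complex.ofReal_re] at hr
  simp [pow_two, h0] at hr
  have hsq : (wirtinger s.J).im ^ 2 = 1 + ‖wirtingerBar s.J‖ ^ 2 := by nlinarith
  -- The square is known; adding the orientation conditions at `1` and `i` cancels the antilinear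
  -- part and selects the positive root.
  have ho1 := s.oriented 1 one_ne_zero
  have hoI := s.oriented Complex.I Complex.I_ne_zero
  rw [apply_eq_wirtinger s.J] at ho1 hoI
  simp at ho1 hoI
  exact ⟨by nlinarith [sq_nonneg ‖wirtingerBar s.J‖], hsq⟩

lemma wirtinger_eq : wirtinger s.J = (wirtinger s.J).im * Complex.I := by
  apply Complex.ext <;> simp [s.wirtinger_re]

lemma I_sub_conj_wirtinger :
    Complex.I - (starRingEnd ℂ) (wirtinger s.J) = (1 + (wirtinger s.J).im : ℝ) * Complex.I := by
  apply Complex.ext <;> simp [s.wirtinger_re]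

lemma I_sub_conj_wirtinger_ne_zero : Complex.I - (starRingEnd ℂ) (wirtinger s.J) ≠ 0 := by
  rw [I_sub_conj_wirtinger]
  have := s.one_le_wirtinger_im.1
  refine mul_ne_zero (Complex.ofReal_ne_zero.2 (by linarith)) Complex.I_ne_zero

lemma norm_beltrami_lt_one : ‖s.beltrami‖ < 1 := by
  obtain ⟨h1, h2⟩ := s.one_le_wirtinger_im
  rw [beltrami, I_sub_conj_wirtinger, norm_div, norm_mul, Complex.norm_I, mul_one,
    Complex.norm_real, Real.norm_of_nonneg (by linarith), div_lt_one (by linarith)]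
  refine lt_of_pow_lt_pow_left₀ 2 (by linarith) (by nlinarith)

/-- A real-linear map is complex-linear for the structure `J` iff its Wirtinger coefficients
satisfy the Beltrami equation. -/
lemma comp_eq_I_mul_iff (A : ℂ →L[ℝ] ℂ) :
    (∀ v, A (s.J v) = Complex.I * A v) ↔ wirtingerBar A = s.beltrami * wirtinger A := by
  set a := wirtinger A with ha
  set b := wirtingerBar A with hb
  have hne := s.I_sub_conj_wirtinger_ne_zero
  rw [beltrami, div_mul_eq_mul_div, eq_div_iff hne]
  constructor
  · intro h
    have h1 := h 1
    have hI := h Complex.I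
    rw [apply_eq_wirtinger A, apply_eq_wirtinger s.J, apply_eq_wirtinger A, ← ha, ← hb] at h1 hI
    simp only [map_add, map_mul, map_one, map_neg, neg_neg, Complex.conj_I, mul_one] at h1 hI
    have hI2 := Complex.I_mul_I
    linear_combination (-1/2 : ℂ) * h1 + (-1/2 : ℂ) * Complex.I * hI + (1/2 : ℂ) *
      (a * wirtinger s.J - a * wirtingerBar s.J - b * (starRingEnd ℂ) (wirtinger s.J)
        + b * (starRingEnd ℂ) (wirtingerBar s.J) - a * Complex.I + b * Complex.I) * hI2
  · intro h v
    have hs := s.wirtinger_eq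
    obtain ⟨h1, h2⟩ := s.one_le_wirtinger_im
    set t := (wirtinger s.J).im with ht
    have hc : (starRingEnd ℂ) (wirtinger s.J) = -(t * Complex.I) := by
      rw [hs]; simp
    have hn := Complex.mul_conj (wirtingerBar s.J)
    rw [Complex.normSq_eq_norm_sq] at hn
    have h2' : (t : ℂ) ^ 2 = 1 + wirtingerBar s.J * (starRingEnd ℂ) (wirtingerBar s.J) := by
      rw [hn]; exact_mod_cast h2
    rw [apply_eq_wirtinger A, apply_eq_wirtinger s.J, apply_eq_wirtinger A, ← ha, ← hb]
    simp only [map_add, map_mul, Complex.conj_conj]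
    rw [hc] at h hne ⊢
    rw [hs]
    have hne2 : (1 + t : ℂ) ≠ 0 := by
      intro h0; apply hne; linear_combination Complex.I * h0
    -- The Beltrami equation solved for `(1 + t) b`; multiplying the goal by `1 + t` allows `b` to
    -- be eliminated, and `t² = 1 + |wirtingerBar J|²` does the rest.
    have hbb : b * (1 + t) = -(Complex.I * (wirtingerBar s.J * a)) := by
      linear_combination -Complex.I * h - b * (1 + t) * (-Complex.I_mul_I)
    apply mul_left_cancel₀ hne2
    have hI2 := Complex.I_mul_I
    linear_combination (- Complex.I * (t + 1) * (starRingEnd ℂ) v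
      + (starRingEnd ℂ) (wirtingerBar s.J) * v) * hbb + a * v * Complex.I * h2'
      + ((1 + t) * (starRingEnd ℂ) v * wirtingerBar s.J * a) * hI2

end LinearComplexStructure

lemma tendsto_beltrami {s : ℕ → LinearComplexStructure} {t : LinearComplexStructure}
    (h : Tendsto (fun n => (s n).J) atTop (𝓝 t.J)) :
    Tendsto (fun n => (s n).beltrami) atTop (𝓝 t.beltrami) := by
  have hc : ContinuousAt (fun J : ℂ →L[ℝ] ℂ =>
      wirtingerBar J / (Complex.I - (starRingEnd ℂ) (wirtinger J))) t.J :=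
    ContinuousAt.div (by fun_prop) (by fun_prop) t.I_sub_conj_wirtinger_ne_zero
  exact hc.tendsto.comp h

/-- The radial retraction of the plane to the closed disk of radius `k`. -/
noncomputable def radialClip (k : ℝ) (m : ℂ) : ℂ := ((k / max k ‖m‖ : ℝ) : ℂ) * m

lemma continuous_radialClip {k : ℝ} (hk : 0 ≤ k) : Continuous (radialClip k) := by
  unfold radialClip
  rcases hk.eq_or_lt with rfl | hk
  · simpa using continuous_const
  · have : ∀ m : ℂ, max k ‖m‖ ≠ 0 := fun m => (lt_max_of_lt_left hk).ne'
    fun_prop (disch := assumption)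

lemma norm_radialClip_le {k : ℝ} (hk : 0 ≤ k) (m : ℂ) : ‖radialClip k m‖ ≤ k := by
  rw [radialClip, norm_mul, Complex.norm_real, Real.norm_of_nonneg (by positivity)]
  rcases hk.eq_or_lt with rfl | hk
  · simp
  · rw [div_mul_eq_mul_div, div_le_iff₀ (lt_max_of_lt_left hk)]
    gcongr
    exact le_max_right _ _

/-- If `a ≠ 0` the bound puts `m` in the disk, where the retraction is the identity; if `a = 0` both
sides vanish. Hence a Beltrami coefficient may be clipped without losing its equation. -/
lemma radialClip_mul_eq {k : ℝ} {m a : ℂ} (h : ‖m * a‖ ≤ k * ‖a‖) :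
    radialClip k m * a = m * a := by
  by_cases ha : a = 0
  · simp [ha]
  have hm : ‖m‖ ≤ k := by
    rw [norm_mul] at h
    exact le_of_mul_le_mul_right h (norm_pos_iff.2 ha)
  rw [radialClip, max_eq_left hm]
  by_cases hk : k = 0
  · have : m = 0 := by simpa [hk] using hm
    simp [this]
  · simp [hk]

/-! ### Mollification in `L²` -/

section Mollification

open scoped Convolution
open ContinuousLinearMap

variable {E F : Type*} [NormedAddCommGroup E] [NormedSpace ℝ E] [FiniteDimensional ℝ E]
  [MeasurableSpace E] [BorelSpace E] (μ : Measure E) [μ.IsAddHaarMeasure]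
  [NormedAddCommGroup F] [NormedSpace ℝ F]

lemma ContDiffBump.lintegral_enorm_normed (φ : ContDiffBump (0 : E)) :
    ∫⁻ t, ‖φ.normed μ t‖ₑ ∂μ = 1 := by
  have h : ∀ t, ‖φ.normed μ t‖ₑ = ENNReal.ofReal (φ.normed μ t) := fun t => by
    rw [Real.enorm_eq_ofReal (φ.nonneg_normed t)]
  simp_rw [h]
  rw [← ofReal_integral_eq_lintegral_ofReal φ.integrable_normed
    (ae_of_all _ φ.nonneg_normed), φ.integral_normed, ENNReal.ofReal_one]

/-- Cauchy–Schwarz with the kernel split as `η^{1/2} · (η^{1/2} |w|)`; the first factor has `L²`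
norm one because the kernel has mass one. -/
lemma ContDiffBump.enorm_convolution_sq_le (φ : ContDiffBump (0 : E)) {w : E → F}
    (hw : AEStronglyMeasurable w μ) (x : E) :
    ‖(φ.normed μ ⋆[lsmul ℝ ℝ, μ] w) x‖ₑ ^ (2 : ℝ) ≤
      ∫⁻ t, ‖φ.normed μ t‖ₑ * ‖w (x - t)‖ₑ ^ (2 : ℝ) ∂μ := by
  have hm : AEMeasurable (fun t => ‖φ.normed μ t‖ₑ) μ :=
    φ.continuous_normed.enorm.aemeasurable
  have hmw : AEMeasurable (fun t => ‖w (x - t)‖ₑ) μ :=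
    (hw.comp_quasiMeasurePreserving
      (quasiMeasurePreserving_sub_left μ x)).enorm
  have h1 : ‖(φ.normed μ ⋆[lsmul ℝ ℝ, μ] w) x‖ₑ ≤
      ∫⁻ t, (‖φ.normed μ t‖ₑ ^ (1 / 2 : ℝ)) *
        (‖φ.normed μ t‖ₑ ^ (1 / 2 : ℝ) * ‖w (x - t)‖ₑ) ∂μ := by
    rw [convolution_def]
    refine (enorm_integral_le_lintegral_enorm _).trans (le_of_eq ?_)
    congr 1 with t
    rw [lsmul_apply, enorm_smul, ← mul_assoc, ← ENNReal.rpow_add_of_nonneg _ _ (by norm_num)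
      (by norm_num)]
    norm_num
  have h2 := ENNReal.lintegral_mul_le_Lp_mul_Lq μ Real.HolderConjugate.two_two
    (hm.pow_const (1 / 2 : ℝ)) ((hm.pow_const (1 / 2 : ℝ)).mul hmw)
  have h3 : (∫⁻ t, (‖φ.normed μ t‖ₑ ^ (1 / 2 : ℝ)) ^ (2 : ℝ) ∂μ) = 1 := by
    simp_rw [← ENNReal.rpow_mul]
    norm_num
    exact φ.lintegral_enorm_normed μ
  have h4 : (∫⁻ t, (‖φ.normed μ t‖ₑ ^ (1 / 2 : ℝ) * ‖w (x - t)‖ₑ) ^ (2 : ℝ) ∂μ) =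
      ∫⁻ t, ‖φ.normed μ t‖ₑ * ‖w (x - t)‖ₑ ^ (2 : ℝ) ∂μ := by
    congr 1 with t
    rw [ENNReal.mul_rpow_of_nonneg _ _ (by norm_num), ← ENNReal.rpow_mul]
    norm_num
  simp only [Pi.mul_apply] at h2
  rw [h3, h4, ENNReal.one_rpow, one_mul] at h2
  calc _ ≤ ((∫⁻ t, ‖φ.normed μ t‖ₑ * ‖w (x - t)‖ₑ ^ (2 : ℝ) ∂μ) ^ (1 / 2 : ℝ)) ^ (2 : ℝ) :=
        ENNReal.rpow_le_rpow (h1.trans h2) (by norm_num)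
    _ = _ := by rw [← ENNReal.rpow_mul]; norm_num

/-- Young's inequality for mollifiers in `L²`. -/
lemma ContDiffBump.eLpNorm_convolution_le (φ : ContDiffBump (0 : E)) {w : E → F}
    (hw : AEStronglyMeasurable w μ) :
    eLpNorm (φ.normed μ ⋆[lsmul ℝ ℝ, μ] w) 2 μ ≤ eLpNorm w 2 μ := by
  rw [eLpNorm_eq_lintegral_rpow_enorm_toReal (by norm_num) (by norm_num),
    eLpNorm_eq_lintegral_rpow_enorm_toReal (by norm_num) (by norm_num)]
  refine ENNReal.rpow_le_rpow ?_ (by positivity)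
  simp only [ENNReal.toReal_ofNat]
  have hmeas : AEMeasurable (fun p : E × E => ‖φ.normed μ p.2‖ₑ * ‖w (p.1 - p.2)‖ₑ ^ (2 : ℝ))
      (μ.prod μ) := by
    refine AEMeasurable.mul ?_ ?_
    · exact (φ.continuous_normed.comp continuous_snd).enorm.aemeasurable
    · exact ((hw.comp_quasiMeasurePreserving
        (quasiMeasurePreserving_sub_of_right_invariant μ μ)).enorm).pow_const _
  calc ∫⁻ x, ‖(φ.normed μ ⋆[lsmul ℝ ℝ, μ] w) x‖ₑ ^ (2 : ℝ) ∂μ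
      ≤ ∫⁻ x, ∫⁻ t, ‖φ.normed μ t‖ₑ * ‖w (x - t)‖ₑ ^ (2 : ℝ) ∂μ ∂μ :=
        lintegral_mono fun x => φ.enorm_convolution_sq_le μ hw x
    _ = ∫⁻ t, ∫⁻ x, ‖φ.normed μ t‖ₑ * ‖w (x - t)‖ₑ ^ (2 : ℝ) ∂μ ∂μ :=
        lintegral_lintegral_swap hmeas
    _ = ∫⁻ t, ‖φ.normed μ t‖ₑ * ∫⁻ x, ‖w x‖ₑ ^ (2 : ℝ) ∂μ ∂μ := by
        congr 1 with t
        rw [lintegral_const_mul' _ _ (by simp),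
          lintegral_sub_right_eq_self (fun x => ‖w x‖ₑ ^ (2 : ℝ)) t]
    _ = _ := by
        rw [lintegral_mul_const _ φ.continuous_normed.enorm.measurable,
          φ.lintegral_enorm_normed μ, one_mul]

/-- Uniform continuity makes the error at most `ε` everywhere, and for radii below `1` it is
supported in the fixed compact set `S`; so its `L²` norm is at most `ε μ(S)^{1/2}`. -/
lemma ContDiffBump.tendsto_eLpNorm_convolution_sub_of_continuous
    {φ : ℕ → ContDiffBump (0 : E)} (hφ : Tendsto (fun n => (φ n).rOut) atTop (𝓝 0))
    [CompleteSpace F] {g : E → F} (hg : Continuous g) (hgc : HasCompactSupport g) :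
    Tendsto (fun n => eLpNorm ((φ n).normed μ ⋆[lsmul ℝ ℝ, μ] g - g) 2 μ) atTop (𝓝 0) := by
  have huc := hgc.uniformContinuous_of_continuous hg
  set S := Metric.cthickening 1 (tsupport g) with hS
  have hSc : IsCompact S := hgc.isCompact.cthickening
  have hSm : μ S ≠ ⊤ := hSc.measure_lt_top.ne
  have hlim : Tendsto (fun ε : ℝ => ENNReal.ofReal ε * μ S ^ (1 / 2 : ℝ)) (𝓝[>] 0) (𝓝 0) := by
    have h0 : Tendsto (fun ε : ℝ => ENNReal.ofReal ε) (𝓝[>] 0) (𝓝 0) := by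
      have := (ENNReal.continuous_ofReal.tendsto 0).mono_left
        (nhdsWithin_le_nhds (s := Set.Ioi (0 : ℝ)))
      simpa using this
    have := ENNReal.Tendsto.mul_const (b := μ S ^ (1 / 2 : ℝ)) h0
      (Or.inr (ENNReal.rpow_ne_top_of_nonneg (by norm_num) hSm))
    simpa using this
  rw [ENNReal.tendsto_nhds_zero]
  intro δ hδ
  obtain ⟨ε, hε, hεpos⟩ := ((hlim.eventually (ge_mem_nhds hδ)).and self_mem_nhdsWithin).exists
  obtain ⟨r, hr, hrg⟩ := Metric.uniformContinuous_iff.1 huc ε hεpos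
  filter_upwards [hφ.eventually (gt_mem_nhds hr), hφ.eventually (gt_mem_nhds one_pos)]
    with n hn hn1
  have hpt : ∀ x, ‖((φ n).normed μ ⋆[lsmul ℝ ℝ, μ] g - g) x‖ ≤ ε := by
    intro x
    rw [Pi.sub_apply, ← dist_eq_norm]
    refine (φ n).dist_normed_convolution_le hg.aestronglyMeasurable fun y hy => ?_
    exact (hrg (lt_trans hy hn)).le
  have hsupp : Function.support ((φ n).normed μ ⋆[lsmul ℝ ℝ, μ] g - g) ⊆ S := by
    intro x hx
    by_contra hxS
    apply hx
    have hball : ∀ y ∈ Metric.ball x (φ n).rOut, g y = 0 := by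
      intro y hy
      refine image_eq_zero_of_notMem_tsupport fun hyt => hxS ?_
      refine Metric.mem_cthickening_of_dist_le x y 1 _ hyt ?_
      rw [dist_comm]; exact (lt_trans hy hn1).le
    have hx0 : g x = 0 := hball x (Metric.mem_ball_self (φ n).rOut_pos)
    rw [Pi.sub_apply, (φ n).normed_convolution_eq_right (fun y hy => by rw [hball y hy, hx0]),
      sub_self]
  refine le_trans ?_ hε
  rw [← eLpNorm_restrict_eq_of_support_subset hsupp]
  refine (eLpNorm_le_of_ae_bound (C := ε) (ae_of_all _ hpt)).trans ?_
  rw [mul_comm]; simp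

/-- Mollifications of an `L²` function converge to it in `L²`. -/
lemma ContDiffBump.tendsto_eLpNorm_convolution_sub
    {φ : ℕ → ContDiffBump (0 : E)} (hφ : Tendsto (fun n => (φ n).rOut) atTop (𝓝 0))
    [CompleteSpace F] {w : E → F} (hw : MemLp w 2 μ) :
    Tendsto (fun n => eLpNorm ((φ n).normed μ ⋆[lsmul ℝ ℝ, μ] w - w) 2 μ) atTop (𝓝 0) := by
  rw [ENNReal.tendsto_nhds_zero]
  intro δ hδ
  have hδ3 : δ / 3 ≠ 0 := by simp [hδ.ne']
  -- Three-epsilon argument: approximate by a compactly supported continuous `g`, and control the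
  -- mollified difference `w - g` by Young's inequality.
  obtain ⟨g, hgc, hwg, hg, -⟩ := hw.exists_hasCompactSupport_eLpNorm_sub_le (by norm_num) hδ3
  have hgL : MemLp g 2 μ := hg.memLp_of_hasCompactSupport hgc
  have ht := ContDiffBump.tendsto_eLpNorm_convolution_sub_of_continuous μ hφ hg hgc
  filter_upwards [(ENNReal.tendsto_nhds_zero.1 ht) (δ / 3) (pos_iff_ne_zero.2 hδ3)] with n hn
  have hli : ∀ {f : E → F}, MemLp f 2 μ →
      ConvolutionExists ((φ n).normed μ) f (lsmul ℝ ℝ) μ := fun hf =>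
    (φ n).hasCompactSupport_normed.convolutionExists_left _ (φ n).continuous_normed
      (hf.locallyIntegrable (by norm_num))
  have hconv : (φ n).normed μ ⋆[lsmul ℝ ℝ, μ] w = (φ n).normed μ ⋆[lsmul ℝ ℝ, μ] (w - g) +
      (φ n).normed μ ⋆[lsmul ℝ ℝ, μ] g := by
    rw [← (hli (hw.sub hgL)).distrib_add (hli hgL), sub_add_cancel]
  have hsm : ∀ {f : E → F}, MemLp f 2 μ →
      AEStronglyMeasurable ((φ n).normed μ ⋆[lsmul ℝ ℝ, μ] f) μ := fun hf =>
    ((φ n).hasCompactSupport_normed.continuous_convolution_left _ (φ n).continuous_normed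
      (hf.locallyIntegrable (by norm_num))).aestronglyMeasurable
  have hsplit : (φ n).normed μ ⋆[lsmul ℝ ℝ, μ] w - w =
      (φ n).normed μ ⋆[lsmul ℝ ℝ, μ] (w - g) + ((φ n).normed μ ⋆[lsmul ℝ ℝ, μ] g - g) +
        (g - w) := by
    rw [hconv]; abel
  rw [hsplit]
  calc _ ≤ eLpNorm ((φ n).normed μ ⋆[lsmul ℝ ℝ, μ] (w - g)) 2 μ +
        eLpNorm ((φ n).normed μ ⋆[lsmul ℝ ℝ, μ] g - g) 2 μ + eLpNorm (g - w) 2 μ := by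
        have h1 := hsm (hw.sub hgL)
        have h2 := (hsm hgL).sub hg.aestronglyMeasurable
        refine (eLpNorm_add_le (h1.add h2) (hg.aestronglyMeasurable.sub hw.1)
          (by norm_num)).trans ?_
        gcongr
        exact eLpNorm_add_le h1 h2 (by norm_num)
    _ ≤ δ / 3 + δ / 3 + δ / 3 := by
        gcongr
        · exact ((φ n).eLpNorm_convolution_le μ (hw.sub hgL).1).trans hwg
        · rw [eLpNorm_sub_comm]; exact hwg
    _ = δ := ENNReal.add_thirds δ

end Mollification

/-! ### Products and pairings of locally square integrable functions -/

section LocalIntegrability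

variable {F : Type*} [NormedAddCommGroup F]

lemma memLp_two_of_continuousOn {f : ℂ → F} {C : Set ℂ} (hC : IsCompact C)
    (hf : ContinuousOn f C) : MemLp f 2 (volume.restrict C) := by
  obtain ⟨M, hM⟩ := hC.exists_bound_of_continuousOn hf
  have : IsFiniteMeasure (volume.restrict C) := ⟨by simpa using hC.measure_lt_top⟩
  exact MemLp.of_bound (hf.aestronglyMeasurable_of_isCompact hC hC.measurableSet) M
    ((ae_restrict_iff' hC.measurableSet).2 (ae_of_all _ hM))

variable [NormedSpace ℝ F]

/-- The product of a continuous compactly supported function with a function that is `L²` on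
its support. -/
lemma memLp_two_smul_of_hasCompactSupport {f : ℂ → ℝ} (hf : Continuous f)
    (hfc : HasCompactSupport f) {g : ℂ → F} (hg : MemLp g 2 (volume.restrict (tsupport f))) :
    MemLp (fun z => f z • g z) 2 volume := by
  have h1 : MemLp ((tsupport f).indicator g) 2 volume :=
    (memLp_indicator_iff_restrict (isClosed_tsupport f).measurableSet).2 hg
  have h2 := MemLp.smul (r := 2) h1 (hf.memLp_top_of_hasCompactSupport hfc volume)
  convert h2 using 1
  ext z
  by_cases hz : z ∈ tsupport f
  · simp [hz]
  · simp [image_eq_zero_of_notMem_tsupport hz]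

lemma integrable_smul_of_hasCompactSupport {f : ℂ → ℝ} (hf : Continuous f)
    (hfc : HasCompactSupport f) {g : ℂ → F} (hg : MemLp g 2 (volume.restrict (tsupport f))) :
    Integrable (fun z => f z • g z) volume := by
  have h1 : MemLp ((tsupport f).indicator g) 2 volume :=
    (memLp_indicator_iff_restrict (isClosed_tsupport f).measurableSet).2 hg
  have h2 := MemLp.smul (r := 1) h1 (hf.memLp_of_hasCompactSupport (p := 2) (μ := volume) hfc)
  rw [← memLp_one_iff_integrable]
  convert h2 using 1
  ext z
  by_cases hz : z ∈ tsupport f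
  · simp [hz]
  · simp [image_eq_zero_of_notMem_tsupport hz]

lemma tendsto_integral_smul_of_tendsto_eLpNorm {μ : Measure ℂ} {w : ℕ → ℂ → ℝ} {w' : ℂ → ℝ}
    {f : ℂ → F} (hf : MemLp f 2 μ) (hw : ∀ n, MemLp (w n) 2 μ) (hw' : MemLp w' 2 μ)
    (h : Tendsto (fun n => eLpNorm (w n - w') 2 μ) atTop (𝓝 0)) :
    Tendsto (fun n => ∫ z, w n z • f z ∂μ) atTop (𝓝 (∫ z, w' z • f z ∂μ)) := by
  refine tendsto_integral_of_L1' _ (hw'.1.smul hf.1) (Eventually.of_forall fun n =>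
    memLp_one_iff_integrable.1 (MemLp.smul (r := 1) hf (hw n))) ?_
  have h0 : Tendsto (fun n => eLpNorm (w n - w') 2 μ * eLpNorm f 2 μ) atTop (𝓝 0) := by
    simpa using ENNReal.Tendsto.mul_const h (Or.inr hf.2.ne)
  refine tendsto_of_tendsto_of_tendsto_of_le_of_le tendsto_const_nhds h0 (fun _ => zero_le)
    fun n => ?_
  have := eLpNorm_smul_le_mul_eLpNorm (p := 2) (q := 2) (r := 1) hf.1 ((hw n).1.sub hw'.1)
  refine le_trans (le_of_eq ?_) this
  congr 1
  ext z
  simp [sub_smul]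

end LocalIntegrability

/-! ### Weak derivatives: mollification and integration by parts -/

section WeakDerivative

open scoped Convolution
open ContinuousLinearMap

variable {U : Set ℂ} {Φ : ℂ → ℂ} {G : ℂ → ℂ →L[ℝ] ℂ}

/-- Mollification commutes with the weak derivative, away from the boundary of the domain. -/
lemma IsWeakDeriv.fderiv_convolution (h : IsWeakDeriv U Φ G) {C : Set ℂ}
    (hCU : C ⊆ U) (hΦ : LocallyIntegrable (C.indicator Φ)) (η : ContDiffBump (0 : ℂ))
    {x : ℂ} (hx : Metric.closedBall x η.rOut ⊆ C) (e : ℂ) :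
    fderiv ℝ (η.normed volume ⋆[lsmul ℝ ℝ, volume] C.indicator Φ) x e =
      (η.normed volume ⋆[lsmul ℝ ℝ, volume] C.indicator (fun z => G z e)) x := by
  have hηc := η.hasCompactSupport_normed (μ := volume)
  have hηs : ContDiff ℝ ∞ (η.normed volume) := η.contDiff_normed
  have hη1 : ContDiff ℝ 1 (η.normed volume) := η.contDiff_normed
  rw [← convolution_flip, (hηc.hasFDerivAt_convolution_right _ hΦ hη1 x).fderiv,
    convolution_precompR_apply _ hΦ (hηc.fderiv ℝ) (hη1.continuous_fderiv one_ne_zero),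
    convolution_def, convolution_eq_swap]
  simp only [flip_apply, lsmul_apply]
  -- The reflected kernel is the test function. Reflection changes the sign of its derivative, which
  -- cancels the sign in the definition of the weak derivative.
  set φ : ℂ → ℝ := fun t => η.normed volume (x - t) with hφ
  have hφs : ContDiff ℝ ∞ φ := hηs.comp (contDiff_const.sub contDiff_id)
  have hsupp : tsupport φ ⊆ Metric.closedBall x η.rOut := by
    refine closure_minimal (fun t ht => ?_) Metric.isClosed_closedBall
    have : x - t ∈ Function.support (η.normed volume) := ht
    rw [η.support_normed_eq, mem_ball_zero_iff] at this
    rw [Metric.mem_closedBall, dist_comm, dist_eq_norm]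
    exact this.le
  have hφc : HasCompactSupport φ :=
    (isCompact_closedBall x η.rOut).of_isClosed_subset (isClosed_tsupport _) hsupp
  have hφd : ∀ t, fderiv ℝ φ t e = -fderiv ℝ (η.normed volume) (x - t) e := by
    intro t
    have h1 : HasFDerivAt (fun t => x - t) (-(ContinuousLinearMap.id ℝ ℂ)) t := by
      simpa using (hasFDerivAt_id (𝕜 := ℝ) t).const_sub x
    have h2 : HasFDerivAt (η.normed volume) (fderiv ℝ (η.normed volume) (x - t)) (x - t) :=
      (hη1.differentiable one_ne_zero).differentiableAt.hasFDerivAt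
    have h3 : fderiv ℝ φ t = _ := (h2.comp t h1).fderiv
    rw [h3]; simp
  have hC0 : ∀ t ∉ C, t ∉ tsupport φ := fun t ht ht' => ht (hx (hsupp ht'))
  have key := h φ hφs hφc ((hsupp.trans hx).trans hCU) e
  have e1 : ∀ t, fderiv ℝ (η.normed volume) (x - t) e • C.indicator Φ t =
      -((fderiv ℝ φ t e) • Φ t) := by
    intro t
    have hd := hφd t
    by_cases ht : t ∈ C
    · simp [ht, hd]
    · have h0 : fderiv ℝ φ t = 0 :=
        image_eq_zero_of_notMem_tsupport fun h => hC0 t ht (tsupport_fderiv_subset ℝ h)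
      simp [ht, h0]
  have e2 : ∀ t, η.normed volume (x - t) • C.indicator (fun z => G z e) t = φ t • G t e := by
    intro t
    by_cases ht : t ∈ C
    · simp [ht, hφ]
    · have h0 : φ t = 0 := image_eq_zero_of_notMem_tsupport (hC0 t ht)
      simp [ht, h0]
  simp_rw [e1, e2]
  rw [integral_neg, key, neg_neg]

lemma fderiv_mul_fderiv_apply {ψ h : ℂ → ℝ} (hψ : ContDiff ℝ ∞ ψ) (hh : ContDiff ℝ ∞ h)
    (z v e : ℂ) : fderiv ℝ (fun z => ψ z * fderiv ℝ h z e) z v =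
      ψ z * fderiv ℝ (fderiv ℝ h) z v e + fderiv ℝ ψ z v * fderiv ℝ h z e := by
  have h1 : DifferentiableAt ℝ (fderiv ℝ h) z :=
    ((hh.fderiv_right (m := 1) (by norm_cast)).differentiable one_ne_zero).differentiableAt
  have h2 : HasFDerivAt (fun z => fderiv ℝ h z e) _ z :=
    h1.hasFDerivAt.clm_apply (hasFDerivAt_const e z)
  change fderiv ℝ (ψ * fun z => fderiv ℝ h z e) z v = _
  rw [((hψ.differentiable (by simp)).differentiableAt.hasFDerivAt.mul h2).fderiv]
  simp
  ring

/-- The Jacobian is a null Lagrangian, with one of the two functions smooth. -/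
lemma HasLocalL2Deriv.integral_smooth_jacobian (hG : HasLocalL2Deriv U Φ G)
    (hΦ : ContinuousOn Φ U) {ψ h : ℂ → ℝ} (hψ : ContDiff ℝ ∞ ψ) (hψc : HasCompactSupport ψ)
    (hψU : tsupport ψ ⊆ U) (hh : ContDiff ℝ ∞ h) :
    (∫ z, fderiv ℝ h z Complex.I • (ψ z • G z 1)) - ∫ z, fderiv ℝ h z 1 • (ψ z • G z Complex.I) =
      -((∫ z, fderiv ℝ h z Complex.I • (fderiv ℝ ψ z 1 • Φ z)) -
        ∫ z, fderiv ℝ h z 1 • (fderiv ℝ ψ z Complex.I • Φ z)) := by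
  have hsm : ∀ e, ContDiff ℝ ∞ (fun z => ψ z * fderiv ℝ h z e) := fun e =>
    hψ.mul ((hh.fderiv_right (m := ∞) (by simp)).clm_apply contDiff_const)
  have hcs : ∀ e, HasCompactSupport (fun z => ψ z * fderiv ℝ h z e) := fun e => hψc.mul_right
  have hts : ∀ e, tsupport (fun z => ψ z * fderiv ℝ h z e) ⊆ U := fun e =>
    (tsupport_mul_subset_left).trans hψU
  -- The weak derivative is tested against `ψ ∂h` in crossed directions; the second derivatives of
  -- `h` then cancel by symmetry, leaving only terms with a derivative of `ψ`.
  have k1 := hG.2 _ (hsm Complex.I) (hcs Complex.I) (hts Complex.I) 1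
  have k2 := hG.2 _ (hsm 1) (hcs 1) (hts 1) Complex.I
  have hint : ∀ e v, Integrable (fun z => fderiv ℝ (fun z => ψ z * fderiv ℝ h z e) z v • Φ z) := by
    intro e v
    refine integrable_smul_of_hasCompactSupport ?_ ((hcs e).fderiv_apply ℝ v) ?_
    · exact ((hsm e).continuous_fderiv (by simp)).clm_apply continuous_const
    · refine memLp_two_of_continuousOn ((hcs e).fderiv_apply ℝ v).isCompact (hΦ.mono ?_)
      exact (tsupport_fderiv_apply_subset ℝ v).trans (hts e)
  have hint2 : ∀ e v, Integrable (fun z => fderiv ℝ h z e • (fderiv ℝ ψ z v • Φ z)) := by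
    intro e v
    have hc : HasCompactSupport (fun z => fderiv ℝ h z e * fderiv ℝ ψ z v) :=
      (hψc.fderiv_apply ℝ v).mul_left
    simp_rw [smul_smul]
    refine integrable_smul_of_hasCompactSupport ?_ hc ?_
    · exact ((hh.continuous_fderiv (by simp)).clm_apply continuous_const).mul
        ((hψ.continuous_fderiv (by simp)).clm_apply continuous_const)
    · refine memLp_two_of_continuousOn hc.isCompact (hΦ.mono ?_)
      exact ((tsupport_mul_subset_right).trans (tsupport_fderiv_apply_subset ℝ v)).trans hψU
  have hsymm : ∀ z, fderiv ℝ (fderiv ℝ h) z 1 Complex.I = fderiv ℝ (fderiv ℝ h) z Complex.I 1 :=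
    fun z => hh.contDiffAt.isSymmSndFDerivAt
      (by rw [minSmoothness_of_isRCLikeNormedField]; exact WithTop.coe_le_coe.2 (le_top : (2 : ℕ∞) ≤ ⊤)) 1 Complex.I
  have e0 : ∀ e v : ℂ, (∫ z, fderiv ℝ h z e • (ψ z • G z v)) =
      ∫ z, (ψ z * fderiv ℝ h z e) • G z v := fun e v => by
    congr 1 with z; rw [smul_smul, mul_comm]
  rw [e0, e0, ← integral_sub (hint2 _ _) (hint2 _ _), ← neg_eq_iff_eq_neg, neg_sub,
    ← neg_sub_neg, ← k1, ← k2, ← integral_sub (hint _ _) (hint _ _)]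
  congr 1 with z
  rw [fderiv_mul_fderiv_apply hψ hh, fderiv_mul_fderiv_apply hψ hh, hsymm, smul_smul, smul_smul,
    ← sub_smul, ← sub_smul]
  congr 1
  ring

end WeakDerivative

/-! ### The Jacobian as a null Lagrangian and the energy estimate -/

section Caccioppoli

open scoped Convolution
open ContinuousLinearMap

variable {U : Set ℂ} {Φ : ℂ → ℂ} {G : ℂ → ℂ →L[ℝ] ℂ}

lemma memLp_two_apply {C : Set ℂ} (h : MemLp G 2 (volume.restrict C)) (e : ℂ) :
    MemLp (fun z => G z e) 2 (volume.restrict C) :=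
  (ContinuousLinearMap.apply ℝ ℂ e).comp_memLp' h

lemma exists_contDiffBump_seq {δ : ℝ} (hδ : 0 < δ) :
    ∃ η : ℕ → ContDiffBump (0 : ℂ), Tendsto (fun n => (η n).rOut) atTop (𝓝 0) ∧
      ∀ n, (η n).rOut ≤ δ := by
  refine ⟨fun n => ⟨δ / (n + 2) / 2, δ / (n + 2), by positivity, half_lt_self (by positivity)⟩,
    ?_, fun n => div_le_self hδ.le ?_⟩
  · have := (tendsto_const_div_atTop_nhds_zero_nat δ).comp (tendsto_add_atTop_nat 2)
    refine this.congr fun n => ?_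
    simp
  · have : (0 : ℝ) ≤ n := n.cast_nonneg
    linarith

/-- Near a compact set, the imaginary part of a map with local `L²` derivatives is approximated
by smooth functions whose derivatives converge weakly in `L²`. -/
lemma HasLocalL2Deriv.exists_smooth_approx (hG : HasLocalL2Deriv U Φ G) (hU : IsOpen U)
    (hΦ : ContinuousOn Φ U) {S : Set ℂ} (hS : IsCompact S) (hSU : S ⊆ U) :
    ∃ h : ℕ → ℂ → ℝ, (∀ n, ContDiff ℝ ∞ (h n)) ∧
      ∀ e, ∀ f : ℂ → ℂ, MemLp f 2 volume → (∀ z ∉ S, f z = 0) →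
        Tendsto (fun n => ∫ z, fderiv ℝ (h n) z e • f z) atTop
          (𝓝 (∫ z, (G z e).im • f z)) := by
  -- Extending by zero outside a `δ`-neighbourhood of `S` is invisible at points of `S` to
  -- mollifiers of radius at most `δ`.
  obtain ⟨δ, hδ, hδU⟩ := hS.exists_cthickening_subset_open hU hSU
  set C := Metric.cthickening δ (S) with hCdef
  have hC : IsCompact C := hS.cthickening
  have hSC : S ⊆ C := Metric.self_subset_cthickening _
  have hGC : ∀ e, MemLp (C.indicator (fun z => G z e)) 2 volume := fun e =>
    (memLp_indicator_iff_restrict hC.measurableSet).2 (memLp_two_apply (hG.1 C hC hδU) e)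
  have hΦL : MemLp (C.indicator Φ) 2 volume :=
    (memLp_indicator_iff_restrict hC.measurableSet).2
      (memLp_two_of_continuousOn hC (hΦ.mono hδU))
  have hΦC : LocallyIntegrable (C.indicator Φ) volume := hΦL.locallyIntegrable one_le_two
  obtain ⟨η, hηlim, hηδ⟩ := exists_contDiffBump_seq hδ
  set V : ℕ → ℂ → ℂ := fun n => (η n).normed volume ⋆[lsmul ℝ ℝ, volume] C.indicator Φ with hV
  set W : ℂ → ℕ → ℂ → ℂ := fun e n =>
    (η n).normed volume ⋆[lsmul ℝ ℝ, volume] C.indicator (fun z => G z e) with hW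
  have hVs : ∀ n, ContDiff ℝ ∞ (V n) := fun n =>
    (η n).hasCompactSupport_normed.contDiff_convolution_left _ (η n).contDiff_normed hΦC
  have hVi : ∀ n, ContDiff ℝ ∞ (fun z => (V n z).im) := fun n =>
    Complex.imCLM.contDiff.comp (hVs n)
  have hderiv : ∀ n e, ∀ z ∈ S,
      fderiv ℝ (fun z => (V n z).im) z e = (W e n z).im := by
    intro n e z hz
    have h1 : HasFDerivAt (fun z => (V n z).im) (Complex.imCLM.comp (fderiv ℝ (V n) z)) z :=
      Complex.imCLM.hasFDerivAt.comp z
        ((hVs n).differentiable (by simp)).differentiableAt.hasFDerivAt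
    rw [h1.fderiv]
    simp only [coe_comp, Function.comp_apply, Complex.imCLM_apply]
    rw [hG.2.fderiv_convolution hδU hΦC (η n) ?_ e]
    intro y hy
    exact Metric.mem_cthickening_of_dist_le y z δ _ hz ((Metric.mem_closedBall.1 hy).trans (hηδ n))
  refine ⟨fun n z => (V n z).im, hVi, fun e f hf hf0 => ?_⟩
  have hWL : ∀ n, MemLp (W e n) 2 volume := fun n =>
    ⟨((η n).hasCompactSupport_normed.continuous_convolution_left _ (η n).continuous_normed
      ((hGC e).locallyIntegrable (by norm_num))).aestronglyMeasurable,
      ((η n).eLpNorm_convolution_le volume (hGC e).1).trans_lt (hGC e).2⟩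
  have h1 := tendsto_integral_smul_of_tendsto_eLpNorm (μ := volume) (w := fun n z => (W e n z).im)
    (w' := fun z => (C.indicator (fun z => G z e) z).im) hf (fun n => (hWL n).im) (hGC e).im ?_
  · convert h1 using 2 with n
    · congr 1 with z
      by_cases hz : z ∈ S
      · rw [hderiv n e z hz]
      · simp [hf0 z hz]
    · congr 1 with z
      by_cases hz : z ∈ S
      · rw [Set.indicator_of_mem (hSC hz)]
      · simp [hf0 z hz]
  · refine tendsto_of_tendsto_of_tendsto_of_le_of_le tendsto_const_nhds
      (ContDiffBump.tendsto_eLpNorm_convolution_sub volume hηlim (hGC e)) (fun _ => zero_le)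
      fun n => eLpNorm_mono fun z => ?_
    simp only [Pi.sub_apply, ← Complex.sub_im]
    exact Complex.abs_im_le_norm _

/-- The Jacobian of a continuous map with local `L²` derivatives is a null Lagrangian. -/
lemma HasLocalL2Deriv.integral_jacobian (hG : HasLocalL2Deriv U Φ G) (hU : IsOpen U)
    (hΦ : ContinuousOn Φ U) {ψ : ℂ → ℝ} (hψ : ContDiff ℝ ∞ ψ) (hψc : HasCompactSupport ψ)
    (hψU : tsupport ψ ⊆ U) :
    (∫ z, (G z Complex.I).im • (ψ z • G z 1)) - ∫ z, (G z 1).im • (ψ z • G z Complex.I) =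
      -((∫ z, (G z Complex.I).im • (fderiv ℝ ψ z 1 • Φ z)) -
        ∫ z, (G z 1).im • (fderiv ℝ ψ z Complex.I • Φ z)) := by
  obtain ⟨h, hh, hlim⟩ := hG.exists_smooth_approx hU hΦ hψc.isCompact hψU
  have hf1 : ∀ e, MemLp (fun z => ψ z • G z e) 2 volume := fun e =>
    memLp_two_smul_of_hasCompactSupport hψ.continuous hψc
      (memLp_two_apply (hG.1 _ hψc.isCompact hψU) e)
  have hf2 : ∀ e, MemLp (fun z => fderiv ℝ ψ z e • Φ z) 2 volume := fun e =>
    memLp_two_smul_of_hasCompactSupport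
      ((hψ.continuous_fderiv (by simp)).clm_apply continuous_const) (hψc.fderiv_apply ℝ e)
      (memLp_two_of_continuousOn (hψc.fderiv_apply ℝ e).isCompact
        (hΦ.mono ((tsupport_fderiv_apply_subset ℝ e).trans hψU)))
  have z1 : ∀ e, ∀ z ∉ tsupport ψ, ψ z • G z e = 0 := fun e z hz => by
    simp [image_eq_zero_of_notMem_tsupport hz]
  have z2 : ∀ e, ∀ z ∉ tsupport ψ, fderiv ℝ ψ z e • Φ z = 0 := fun e z hz => by
    have : fderiv ℝ ψ z e = 0 := image_eq_zero_of_notMem_tsupport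
      (f := fun z => fderiv ℝ ψ z e) fun h => hz (tsupport_fderiv_apply_subset ℝ e h)
    simp [this]
  -- For smooth `h n` approximating the imaginary part of `Φ` the identity is known; each side is
  -- linear in the derivative of `h n`, so weak convergence suffices.
  refine tendsto_nhds_unique (((hlim _ _ (hf1 1) (z1 1)).sub
    (hlim _ _ (hf1 Complex.I) (z1 Complex.I))).congr fun n => ?_)
    ((hlim _ _ (hf2 1) (z2 1)).sub (hlim _ _ (hf2 Complex.I) (z2 Complex.I))).neg
  exact hG.integral_smooth_jacobian hΦ hψ hψc hψU (hh n)

/-- The Caccioppoli inequality for maps of bounded distortion. -/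
lemma HasLocalL2Deriv.caccioppoli (hG : HasLocalL2Deriv U Φ G) (hU : IsOpen U)
    (hΦ : ContinuousOn Φ U) {K : ℝ} (hK : 0 ≤ K)
    (hdist : ∀ᵐ z ∂(volume.restrict U), ‖G z‖ ^ 2 ≤ K * (G z).det)
    {φ : ℂ → ℝ} (hφ : ContDiff ℝ ∞ φ) (hφc : HasCompactSupport φ) (hφU : tsupport φ ⊆ U) :
    ∫ z, φ z ^ 2 * ‖G z‖ ^ 2 ≤ 16 * K ^ 2 * ∫ z, ‖fderiv ℝ φ z‖ ^ 2 * ‖Φ z‖ ^ 2 := by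
  -- The squared cutoff has derivative `2 φ dφ`, which leaves one factor `φ` to accompany `G` so
  -- that it can be absorbed.
  set ψ : ℂ → ℝ := fun z => φ z * φ z with hψdef
  have hψ : ContDiff ℝ ∞ ψ := hφ.mul hφ
  have hψc : HasCompactSupport ψ := hφc.mul_right
  have hψU : tsupport ψ ⊆ U := tsupport_mul_subset_left.trans hφU
  have hdψ : ∀ z e, fderiv ℝ ψ z e = 2 * φ z * fderiv ℝ φ z e := by
    intro z e
    have h1 := (hφ.differentiable (by simp)).differentiableAt (x := z) |>.hasFDerivAt
    have h2 : fderiv ℝ ψ z = _ := (h1.mul h1).fderiv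
    rw [h2]; simp; ring
  have hGS := hG.1 _ hφc.isCompact hφU
  have hφ0 : ∀ z ∉ U, φ z = 0 := fun z hz =>
    image_eq_zero_of_notMem_tsupport fun h => hz (hφU h)
  have hφG : MemLp (fun z => φ z • G z) 2 volume :=
    memLp_two_smul_of_hasCompactSupport hφ.continuous hφc hGS
  have hdφ : Continuous fun z => ‖fderiv ℝ φ z‖ := (hφ.continuous_fderiv (by simp)).norm
  have hdφc : HasCompactSupport fun z => ‖fderiv ℝ φ z‖ := (hφc.fderiv ℝ).norm
  have hdφU : tsupport (fun z => ‖fderiv ℝ φ z‖) ⊆ U :=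
    (closure_mono fun z hz => by simpa using hz : tsupport (fun z => ‖fderiv ℝ φ z‖) ⊆
      tsupport (fderiv ℝ φ)).trans ((tsupport_fderiv_subset ℝ).trans hφU)
  have hdΦ : MemLp (fun z => ‖fderiv ℝ φ z‖ • Φ z) 2 volume :=
    memLp_two_smul_of_hasCompactSupport hdφ hdφc
      (memLp_two_of_continuousOn hdφc.isCompact (hΦ.mono hdφU))
  have i1 : Integrable (fun z => φ z ^ 2 * ‖G z‖ ^ 2) := by
    refine (memLp_two_iff_integrable_sq_norm hφG.1).1 hφG |>.congr (ae_of_all _ fun z => ?_)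
    simp [norm_smul, mul_pow]
  have i2 : Integrable (fun z => ‖fderiv ℝ φ z‖ ^ 2 * ‖Φ z‖ ^ 2) := by
    refine (memLp_two_iff_integrable_sq_norm hdΦ.1).1 hdΦ |>.congr (ae_of_all _ fun z => ?_)
    simp [mul_pow]
  have hφGe : ∀ e, MemLp (fun z => φ z • G z e) 2 volume := fun e =>
    memLp_two_smul_of_hasCompactSupport hφ.continuous hφc (memLp_two_apply hGS e)
  have i3 : ∀ e v, Integrable (fun z => (G z e).im • (ψ z • G z v)) := by
    intro e v
    have h1 : MemLp (fun z => (φ z • G z e).im) 2 volume := (hφGe e).im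
    refine (memLp_one_iff_integrable.1 (MemLp.smul (r := 1) (hφGe v) h1)).congr
      (ae_of_all _ fun z => ?_)
    simp [hψdef]; ring
  have i4 : ∀ e v, Integrable (fun z => (G z e).im • (fderiv ℝ ψ z v • Φ z)) := by
    intro e v
    have h1 : MemLp (fun z => (φ z • G z e).im) 2 volume := (hφGe e).im
    have h2 : MemLp (fun z => fderiv ℝ φ z v • Φ z) 2 volume :=
      memLp_two_smul_of_hasCompactSupport
        ((hφ.continuous_fderiv (by simp)).clm_apply continuous_const) (hφc.fderiv_apply ℝ v)
        (memLp_two_of_continuousOn (hφc.fderiv_apply ℝ v).isCompact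
          (hΦ.mono ((tsupport_fderiv_apply_subset ℝ v).trans hφU)))
    refine ((memLp_one_iff_integrable.1 (MemLp.smul (r := 1) h2 h1)).smul (2 : ℝ)).congr
      (ae_of_all _ fun z => ?_)
    simp [hdψ]; ring
  have key := hG.integral_jacobian hU hΦ hψ hψc hψU
  rw [← integral_sub (i3 _ _) (i3 _ _), ← integral_sub (i4 _ _) (i4 _ _)] at key
  have hre := congrArg Complex.re key
  have hdet : ∫ z, ψ z * (G z).det = (∫ z, (G z Complex.I).im • (ψ z • G z 1) -
      (G z 1).im • (ψ z • G z Complex.I)).re := by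
    have := integral_re ((i3 Complex.I 1).sub (i3 1 Complex.I))
    simp only [Pi.sub_apply, RCLike.re_eq_complex_re] at this
    rw [← this]
    congr 1 with z
    rw [det_eq_re_im]
    simp
    ring
  have idet : Integrable (fun z => ψ z * (G z).det) := by
    refine ((i3 Complex.I 1).sub (i3 1 Complex.I)).re.congr (ae_of_all _ fun z => ?_)
    simp [det_eq_re_im]
    ring
  have step1 : ∫ z, φ z ^ 2 * ‖G z‖ ^ 2 ≤ K * ∫ z, ψ z * (G z).det := by
    rw [← integral_const_mul]
    refine integral_mono_ae i1 (idet.const_mul K) ?_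
    rw [ae_restrict_iff' hU.measurableSet] at hdist
    filter_upwards [hdist] with z hz
    by_cases hzU : z ∈ U
    · have := mul_le_mul_of_nonneg_left (hz hzU) (sq_nonneg (φ z))
      simp only [hψdef]
      linarith
    · simp [hψdef, hφ0 z hzU]
  -- With `x = |φ| ‖G‖` and `y = ‖dφ‖ |Φ|`, the integrand is at most `4 K x y ≤ x²/2 + 8 K² y²`.
  -- Absorbing the half into the left side doubles `8 K²` to `16 K²`.
  have step2 : K * ∫ z, ψ z * (G z).det ≤
      ∫ z, (1 / 2 * (φ z ^ 2 * ‖G z‖ ^ 2) + 8 * K ^ 2 * (‖fderiv ℝ φ z‖ ^ 2 * ‖Φ z‖ ^ 2)) := by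
    rw [hdet, hre, Complex.neg_re]
    refine (mul_le_mul_of_nonneg_left ((neg_le_abs _).trans
      ((Complex.abs_re_le_norm _).trans (norm_integral_le_integral_norm _))) hK).trans ?_
    rw [← integral_const_mul]
    refine integral_mono (((i4 _ _).sub (i4 _ _)).norm.const_mul K)
      ((i1.const_mul _).add (i2.const_mul _)) fun z => ?_
    have b1 : ∀ e v : ℂ, ‖e‖ = 1 → ‖v‖ = 1 → ‖(G z e).im • (fderiv ℝ ψ z v • Φ z)‖ ≤
        2 * (|φ z| * ‖G z‖) * (‖fderiv ℝ φ z‖ * ‖Φ z‖) := by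
      intro e v he hv
      have h1 : |(G z e).im| ≤ ‖G z‖ := (Complex.abs_im_le_norm _).trans (by
        simpa [he] using (G z).le_opNorm e)
      have h2 : |fderiv ℝ φ z v| ≤ ‖fderiv ℝ φ z‖ := by
        simpa [hv] using (fderiv ℝ φ z).le_opNorm v
      rw [norm_smul, norm_smul, hdψ, Real.norm_eq_abs, Real.norm_eq_abs, abs_mul, abs_mul,
        abs_two]
      calc |(G z e).im| * (2 * |φ z| * |fderiv ℝ φ z v| * ‖Φ z‖)
          ≤ ‖G z‖ * (2 * |φ z| * ‖fderiv ℝ φ z‖ * ‖Φ z‖) := by gcongr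
        _ = _ := by ring
    have b2 := (norm_sub_le _ _).trans (add_le_add (b1 Complex.I 1 (by simp) (by simp))
      (b1 1 Complex.I (by simp) (by simp)))
    have b3 := mul_le_mul_of_nonneg_left b2 hK
    refine b3.trans ?_
    rw [← sq_abs (φ z)]
    nlinarith [sq_nonneg (|φ z| * ‖G z‖ - 4 * K * (‖fderiv ℝ φ z‖ * ‖Φ z‖))]
  rw [integral_add (i1.const_mul _) (i2.const_mul _), integral_const_mul,
    integral_const_mul] at step2
  linarith

lemma exists_cutoff {C : Set ℂ} (hC : IsCompact C) (hU : IsOpen U) (hCU : C ⊆ U) :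
    ∃ φ : ℂ → ℝ, ContDiff ℝ ∞ φ ∧ HasCompactSupport φ ∧ tsupport φ ⊆ U ∧ ∀ z ∈ C, φ z = 1 := by
  obtain ⟨δ, hδ, hδU⟩ := hC.exists_cthickening_subset_open hU hCU
  have hT : IsCompact (Metric.cthickening δ C) := hC.cthickening
  obtain ⟨f, hf1, hf0, -⟩ := exists_contMDiffMap_one_nhds_of_subset_interior (n := (⊤ : ℕ∞))
    (modelWithCornersSelf ℝ ℂ) hC.isClosed (t := Metric.cthickening δ C)
    ((Metric.self_subset_thickening hδ C).trans
      (interior_maximal (Metric.thickening_subset_cthickening δ C) Metric.isOpen_thickening))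
  have hts : tsupport f ⊆ Metric.cthickening δ C :=
    closure_minimal (fun z hz => by_contra fun h => hz (hf0 z h)) hT.isClosed
  exact ⟨f, f.contMDiff.contDiff, hT.of_isClosed_subset (isClosed_tsupport _) hts,
    hts.trans hδU, fun z hz => hf1.self_of_nhdsSet z hz⟩

/-- The energy of a map of bounded distortion on a compact set is controlled by its supremum. -/
lemma exists_lintegral_enorm_sq_le (hU : IsOpen U) {C : Set ℂ} (hC : IsCompact C) (hCU : C ⊆ U)
    {K : ℝ} (hK : 0 ≤ K) {Φ : ℕ → ℂ → ℂ} {G : ℕ → ℂ → ℂ →L[ℝ] ℂ}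
    (hG : ∀ n, HasLocalL2Deriv U (Φ n) (G n)) (hΦ : ∀ n, ContinuousOn (Φ n) U)
    (hbdd : ∀ S, IsCompact S → S ⊆ U → ∃ M, ∀ n, ∀ z ∈ S, ‖Φ n z‖ ≤ M)
    (hdist : ∀ n, ∀ᵐ z ∂(volume.restrict U), ‖G n z‖ ^ 2 ≤ K * (G n z).det) :
    ∃ B : ℝ, 0 ≤ B ∧ ∀ n, ∫⁻ z in C, ‖G n z‖ₑ ^ 2 ≤ ENNReal.ofReal B := by
  obtain ⟨φ, hφ, hφc, hφU, hφ1⟩ := exists_cutoff hC hU hCU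
  obtain ⟨M, hM⟩ := hbdd _ hφc.isCompact hφU
  have hid : Integrable fun z => ‖fderiv ℝ φ z‖ ^ 2 * M ^ 2 := by
    refine Integrable.mul_const ?_ _
    refine ((hφ.continuous_fderiv (by simp)).norm.pow 2).integrable_of_hasCompactSupport ?_
    simp_rw [pow_two]
    exact (hφc.fderiv ℝ).norm.mul_right
  have hB : 0 ≤ ∫ z, ‖fderiv ℝ φ z‖ ^ 2 * M ^ 2 := integral_nonneg fun z => by positivity
  refine ⟨16 * K ^ 2 * ∫ z, ‖fderiv ℝ φ z‖ ^ 2 * M ^ 2, by positivity, fun n => ?_⟩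
  have hφG : MemLp (fun z => φ z • G n z) 2 volume :=
    memLp_two_smul_of_hasCompactSupport hφ.continuous hφc ((hG n).1 _ hφc.isCompact hφU)
  have i1 : Integrable (fun z => φ z ^ 2 * ‖G n z‖ ^ 2) := by
    refine (memLp_two_iff_integrable_sq_norm hφG.1).1 hφG |>.congr (ae_of_all _ fun z => ?_)
    simp [norm_smul, mul_pow]
  have hle : ∫ z, φ z ^ 2 * ‖G n z‖ ^ 2 ≤ 16 * K ^ 2 * ∫ z, ‖fderiv ℝ φ z‖ ^ 2 * M ^ 2 := by
    refine ((hG n).caccioppoli hU (hΦ n) hK (hdist n) hφ hφc hφU).trans ?_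
    refine mul_le_mul_of_nonneg_left (integral_mono_of_nonneg
      (ae_of_all _ fun z => by positivity) hid (ae_of_all _ fun z => ?_)) (by positivity)
    by_cases hz : z ∈ tsupport φ
    · have := hM n z hz
      simp only
      gcongr
    · have : fderiv ℝ φ z = 0 :=
        image_eq_zero_of_notMem_tsupport fun h => hz (tsupport_fderiv_subset ℝ h)
      simp [this]
  calc ∫⁻ z in C, ‖G n z‖ₑ ^ 2
      = ∫⁻ z in C, ENNReal.ofReal (φ z ^ 2 * ‖G n z‖ ^ 2) := by
        refine setLIntegral_congr_fun hC.measurableSet fun z hz => ?_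
        simp only [hφ1 z hz, one_pow, one_mul]
        rw [ENNReal.ofReal_pow (norm_nonneg _), ofReal_norm]
    _ ≤ ∫⁻ z, ENNReal.ofReal (φ z ^ 2 * ‖G n z‖ ^ 2) := setLIntegral_le_lintegral _ _
    _ = ENNReal.ofReal (∫ z, φ z ^ 2 * ‖G n z‖ ^ 2) :=
        (ofReal_integral_eq_lintegral_ofReal i1 (ae_of_all _ fun z => by positivity)).symm
    _ ≤ _ := ENNReal.ofReal_le_ofReal hle

end Caccioppoli

/-! ### Weak limits in `L²` and products with strongly convergent factors -/

section WeakLimits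

variable {α : Type*} [MeasurableSpace α] {μ : Measure α}

/-- `f` is the weak limit in `L²` of the sequence `u` along the filter `F`. -/
def IsWeakL2Limit (μ : Measure α) (F : Filter ℕ) (u : ℕ → α → ℂ) (f : α → ℂ) : Prop :=
  ∀ g : α → ℂ, MemLp g 2 μ → Tendsto (fun n => ∫ z, g z * u n z ∂μ) F (𝓝 (∫ z, g z * f z ∂μ))

/-- Banach–Alaoglu in the dual, transported by the Riesz isometry. Along an ultrafilter compactness
gives convergence directly, with no choice of subsequence. -/
lemma exists_weak_limit_of_bounded {H : Type*} [NormedAddCommGroup H] [InnerProductSpace ℂ H]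
    [CompleteSpace H] (F : Ultrafilter ℕ) {x : ℕ → H} {R : ℝ} (hx : ∀ n, ‖x n‖ ≤ R) :
    ∃ y : H, ∀ h : H, Tendsto (fun n => inner ℂ (x n) h) F (𝓝 (inner ℂ y h)) := by
  have hmem : ∀ n, StrongDual.toWeakDual (InnerProductSpace.toDual ℂ H (x n)) ∈
      WeakDual.toStrongDual ⁻¹' Metric.closedBall (0 : StrongDual ℂ H) R := by
    intro n
    have h1 : InnerProductSpace.toDual ℂ H (x n) ∈ Metric.closedBall (0 : StrongDual ℂ H) R := by
      rw [mem_closedBall_zero_iff, LinearIsometryEquiv.norm_map]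
      exact hx n
    exact h1
  obtain ⟨L, -, hL⟩ := (WeakDual.isCompact_closedBall (0 : StrongDual ℂ H) R).ultrafilter_le_nhds
    (F.map fun n => StrongDual.toWeakDual (InnerProductSpace.toDual ℂ H (x n)))
    (le_principal_iff.2 (mem_map.2 (univ_mem' hmem)))
  refine ⟨(InnerProductSpace.toDual ℂ H).symm (WeakDual.toStrongDual L), fun h => ?_⟩
  rw [InnerProductSpace.toDual_symm_apply]
  have h1 : Tendsto (fun n => StrongDual.toWeakDual (InnerProductSpace.toDual ℂ H (x n))) F
      (𝓝 L) := hL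
  exact ((WeakDual.eval_continuous h).tendsto L).comp h1

lemma exists_isWeakL2Limit (F : Ultrafilter ℕ) {u : ℕ → α → ℂ} (hu : ∀ n, MemLp (u n) 2 μ)
    {R : ℝ≥0∞} (hR : R ≠ ⊤) (hb : ∀ n, eLpNorm (u n) 2 μ ≤ R) :
    ∃ f, MemLp f 2 μ ∧ IsWeakL2Limit μ F u f := by
  obtain ⟨y, hy⟩ := exists_weak_limit_of_bounded F (x := fun n => (hu n).toLp (u n))
    (R := R.toReal) (fun n => by
      rw [Lp.norm_toLp]; exact ENNReal.toReal_mono hR (hb n))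
  refine ⟨y, Lp.memLp y, fun g hg => ?_⟩
  -- Weak limits here use the bilinear pairing, so the Hilbert space pairing is applied to the
  -- conjugate of `g` and then conjugated.
  have hgs : MemLp (fun z => (starRingEnd ℂ) (g z)) 2 μ := hg.star
  have key : ∀ v : Lp ℂ 2 μ, ∀ f : α → ℂ, v =ᵐ[μ] f →
      (starRingEnd ℂ) (inner ℂ v (hgs.toLp _)) = ∫ z, g z * f z ∂μ := by
    intro v f hv
    rw [inner_conj_symm, L2.inner_def]
    refine integral_congr_ae ?_
    filter_upwards [hv, hgs.coeFn_toLp] with z h1 h2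
    rw [h1, h2, RCLike.inner_apply, Complex.conj_conj, mul_comm]
  have h1 := (Complex.continuous_conj.tendsto _).comp (hy (hgs.toLp _))
  rw [key y y (ae_eq_refl _)] at h1
  refine h1.congr fun n => ?_
  exact key _ _ (hu n).coeFn_toLp

/-- Testing with the conjugate of `f - f'` shows that the difference has zero `L²` norm. -/
lemma IsWeakL2Limit.ae_eq {F : Filter ℕ} [F.NeBot] {u : ℕ → α → ℂ} {f f' : α → ℂ}
    (h : IsWeakL2Limit μ F u f) (h' : IsWeakL2Limit μ F u f') (hf : MemLp f 2 μ)
    (hf' : MemLp f' 2 μ) : f =ᵐ[μ] f' := by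
  have hd : MemLp (f - f') 2 μ := hf.sub hf'
  have hg : MemLp (fun z => (starRingEnd ℂ) ((f - f') z)) 2 μ := hd.star
  have heq := tendsto_nhds_unique (h _ hg) (h' _ hg)
  have hi : ∀ {k : α → ℂ}, MemLp k 2 μ →
      Integrable (fun z => (starRingEnd ℂ) ((f - f') z) * k z) μ := fun hk =>
    memLp_one_iff_integrable.1 (MemLp.mul' (r := 1) hk hg)
  have h0 : ∫ z, (starRingEnd ℂ) ((f - f') z) * (f - f') z ∂μ = 0 := by
    simp only [Pi.sub_apply, mul_sub] at hi heq ⊢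
    rw [integral_sub (hi hf) (hi hf'), heq, sub_self]
  have h1 : ∫ z, ‖(f - f') z‖ ^ 2 ∂μ = 0 := by
    have : ∀ z, (starRingEnd ℂ) ((f - f') z) * (f - f') z = ((‖(f - f') z‖ ^ 2 : ℝ) : ℂ) := by
      intro z; rw [mul_comm, Complex.mul_conj, Complex.normSq_eq_norm_sq]
    simp_rw [this] at h0
    rw [integral_complex_ofReal] at h0
    exact_mod_cast h0
  rw [integral_eq_zero_iff_of_nonneg (fun z => by positivity)
    ((memLp_two_iff_integrable_sq_norm hd.1).1 hd)] at h1
  filter_upwards [h1] with z hz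
  have : (f - f') z = 0 := by simpa using hz
  exact sub_eq_zero.1 this

/-- Multiplication by a bounded, almost everywhere convergent sequence is compatible with weak
convergence in `L²`. -/
lemma IsWeakL2Limit.mul {F : Filter ℕ} [F.NeBot] (hF : F ≤ atTop) {u : ℕ → α → ℂ} {f : α → ℂ}
    (hf : MemLp f 2 μ) (h : IsWeakL2Limit μ F u f) (hu : ∀ n, MemLp (u n) 2 μ)
    {R : ℝ≥0∞} (hR : R ≠ ⊤) (hb : ∀ n, eLpNorm (u n) 2 μ ≤ R)
    {m : ℕ → α → ℂ} {m' : α → ℂ} (hm : ∀ n, AEStronglyMeasurable (m n) μ)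
    (hm1 : ∀ n, ∀ᵐ z ∂μ, ‖m n z‖ ≤ 1)
    (hlim : ∀ᵐ z ∂μ, Tendsto (fun n => m n z) atTop (𝓝 (m' z))) :
    MemLp (fun z => m' z * f z) 2 μ ∧
      IsWeakL2Limit μ F (fun n z => m n z * u n z) (fun z => m' z * f z) := by
  have hm' : AEStronglyMeasurable m' μ := aestronglyMeasurable_of_tendsto_ae atTop hm hlim
  have hm'1 : ∀ᵐ z ∂μ, ‖m' z‖ ≤ 1 := by
    filter_upwards [ae_all_iff.2 hm1, hlim] with z h1 h2
    exact le_of_tendsto h2.norm (Eventually.of_forall h1)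
  have hmt : MemLp m' ⊤ μ := memLp_top_of_bound hm' 1 hm'1
  refine ⟨MemLp.mul' (r := 2) hf hmt, fun g hg => ?_⟩
  have hgm : MemLp (fun z => g z * m' z) 2 μ := MemLp.mul' (r := 2) hmt hg
  have hgmn : ∀ n, MemLp (fun z => g z * m n z) 2 μ := fun n =>
    MemLp.mul' (r := 2) (memLp_top_of_bound (hm n) 1 (hm1 n)) hg
  -- Strong convergence of `g m_n`, by domination with `2 |g|`; paired with the bounded `u n` the
  -- error tends to zero.
  have hsmall : Tendsto (fun n => eLpNorm (fun z => g z * m n z - g z * m' z) 2 μ) atTop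
      (𝓝 0) := by
    have hl : Tendsto (fun n => ∫⁻ z, ‖g z * m n z - g z * m' z‖ₑ ^ (2 : ℝ) ∂μ) atTop
        (𝓝 (∫⁻ _, 0 ∂μ)) := by
      refine tendsto_lintegral_of_dominated_convergence' (fun z => (2 * ‖g z‖ₑ) ^ (2 : ℝ))
        (fun n => (((hgmn n).1.sub hgm.1).enorm).pow_const _) (fun n => ?_) ?_ ?_
      · filter_upwards [hm1 n, hm'1] with z h1 h2
        refine ENNReal.rpow_le_rpow ?_ (by norm_num)
        rw [← ofReal_norm, ← ofReal_norm, ← ENNReal.ofReal_ofNat 2,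
          ← ENNReal.ofReal_mul (by norm_num)]
        refine ENNReal.ofReal_le_ofReal ?_
        rw [← mul_sub, norm_mul]
        have := norm_sub_le (m n z) (m' z)
        nlinarith [norm_nonneg (g z)]
      · have h2 := (MemLp.const_mul hg (2 : ℂ)).2
        rw [eLpNorm_lt_top_iff_lintegral_rpow_enorm_lt_top (by norm_num) (by norm_num)] at h2
        have h3 : ‖(2 : ℂ)‖ₑ = 2 := by rw [← ofReal_norm]; simp
        simpa [enorm_mul, h3] using h2.ne
      · filter_upwards [hlim] with z hz
        have h1 : Tendsto (fun n => g z * m n z - g z * m' z) atTop (𝓝 0) := by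
          simpa using (hz.const_mul (g z)).sub_const (g z * m' z)
        have h2 := (ENNReal.continuous_rpow_const (y := 2)).tendsto 0 |>.comp
          ((continuous_enorm.tendsto (0 : ℂ)).comp h1 |>.trans (by simp))
        simpa [Function.comp_def] using h2
    simp only [lintegral_zero] at hl
    have h3 := (ENNReal.continuous_rpow_const (y := (1 / 2 : ℝ))).tendsto 0 |>.comp hl
    simp_rw [eLpNorm_eq_lintegral_rpow_enorm_toReal (two_ne_zero) (ENNReal.ofNat_ne_top)]
    simpa [Function.comp_def] using h3
  have hdiff : Tendsto (fun n => ∫ z, (g z * m n z - g z * m' z) * u n z ∂μ) atTop (𝓝 0) := by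
    have h0 : Tendsto (fun n => eLpNorm (fun z => g z * m n z - g z * m' z) 2 μ * R) atTop
        (𝓝 0) := by
      simpa using ENNReal.Tendsto.mul_const hsmall (Or.inr hR)
    rw [tendsto_iff_enorm_sub_tendsto_zero]
    refine tendsto_of_tendsto_of_tendsto_of_le_of_le tendsto_const_nhds h0 (fun _ => zero_le)
      fun n => ?_
    simp only [sub_zero]
    refine (enorm_integral_le_lintegral_enorm _).trans ?_
    rw [← eLpNorm_one_eq_lintegral_enorm]
    refine (eLpNorm_smul_le_mul_eLpNorm (p := 2) (q := 2) (r := 1) (hu n).1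
      ((hgmn n).1.sub hgm.1)).trans ?_
    exact mul_le_mul_right (hb n) _
  have h1 := (h _ hgm).add (hdiff.mono_left hF)
  rw [add_zero] at h1
  have e1 : ∫ z, g z * m' z * f z ∂μ = ∫ z, g z * (m' z * f z) ∂μ := by simp_rw [mul_assoc]
  rw [e1] at h1
  refine h1.congr fun n => ?_
  have i1 : Integrable (fun z => g z * m' z * u n z) μ :=
    memLp_one_iff_integrable.1 (MemLp.mul' (r := 1) (hu n) hgm)
  have i2 : Integrable (fun z => (g z * m n z - g z * m' z) * u n z) μ :=
    memLp_one_iff_integrable.1 (MemLp.mul' (r := 1) (hu n) ((hgmn n).sub hgm))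
  rw [← integral_add i1 i2]
  congr 1 with z
  ring

end WeakLimits

/-! ### Passing to the limit in the Beltrami equation -/

section BeltramiLimits

variable {α : Type*}

/-- At each point, the last quotient `f k / h k`, `k ≤ n`, with nonvanishing denominator. -/
noncomputable def lastQuotient (f h : ℕ → α → ℂ) : ℕ → α → ℂ
  | 0, z => f 0 z / h 0 z
  | n + 1, z => open Classical in
      if h (n + 1) z = 0 then lastQuotient f h n z else f (n + 1) z / h (n + 1) z

lemma measurable_lastQuotient [MeasurableSpace α] {f h : ℕ → α → ℂ} (hf : ∀ n, Measurable (f n))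
    (hh : ∀ n, Measurable (h n)) (n : ℕ) : Measurable (lastQuotient f h n) := by
  induction n with
  | zero => exact (hf 0).div (hh 0)
  | succ n ih =>
    exact Measurable.ite ((hh (n + 1)) (measurableSet_singleton 0)) ih ((hf _).div (hh _))

variable {f h m : ℕ → α → ℂ} {z : α}

lemma lastQuotient_mul (hfh : ∀ n, f n z = m n z * h n z) (n : ℕ) :
    lastQuotient f h n z * h n z = f n z := by
  cases n with
  | zero =>
    by_cases h0 : h 0 z = 0
    · simp [hfh, h0]
    · simp [lastQuotient, h0]
  | succ n =>
    by_cases h0 : h (n + 1) z = 0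
    · simp [hfh, h0]
    · simp [lastQuotient, h0]

lemma lastQuotient_of_ne_zero (hfh : ∀ n, f n z = m n z * h n z) {n : ℕ} (hn : h n z ≠ 0) :
    lastQuotient f h n z = m n z := by
  have := lastQuotient_mul hfh n
  rw [hfh] at this
  exact mul_right_cancel₀ hn this

lemma lastQuotient_succ_of_eq_zero {n : ℕ} (hn : h (n + 1) z = 0) :
    lastQuotient f h (n + 1) z = lastQuotient f h n z := by
  simp [lastQuotient, hn]

lemma norm_lastQuotient_le (hfh : ∀ n, f n z = m n z * h n z) (hm : ∀ n, ‖m n z‖ ≤ 1) (n : ℕ) :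
    ‖lastQuotient f h n z‖ ≤ 1 := by
  induction n with
  | zero =>
    by_cases h0 : h 0 z = 0
    · simp [lastQuotient, h0]
    · rw [lastQuotient_of_ne_zero hfh h0]; exact hm 0
  | succ n ih =>
    by_cases h0 : h (n + 1) z = 0
    · rwa [lastQuotient_succ_of_eq_zero h0]
    · rw [lastQuotient_of_ne_zero hfh h0]; exact hm _

/-- Past an index `k ≥ N` with nonzero denominator, every quotient is some `m j z` with `j ≥ N`: a
zero denominator only repeats an earlier value. -/
lemma tendsto_lastQuotient_of_frequently (hfh : ∀ n, f n z = m n z * h n z) {c : ℂ}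
    (hlim : Tendsto (fun n => m n z) atTop (𝓝 c)) (hfr : ∃ᶠ n in atTop, h n z ≠ 0) :
    Tendsto (fun n => lastQuotient f h n z) atTop (𝓝 c) := by
  intro s hs
  obtain ⟨N, hN⟩ := eventually_atTop.1 (hlim hs)
  obtain ⟨k, hkN, hk⟩ := frequently_atTop.1 hfr N
  refine mem_map.2 (eventually_atTop.2 ⟨k, fun n hn => ?_⟩)
  change lastQuotient f h n z ∈ s
  induction n, hn using Nat.le_induction with
  | base => rw [lastQuotient_of_ne_zero hfh hk]; exact hN k hkN
  | succ n hn ih =>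
    by_cases h0 : h (n + 1) z = 0
    · rwa [lastQuotient_succ_of_eq_zero h0]
    · rw [lastQuotient_of_ne_zero hfh h0]; exact hN _ (hkN.trans (hn.trans n.le_succ))

lemma exists_tendsto_lastQuotient (hz : ∀ᶠ n in atTop, h n z = 0) :
    ∃ c, Tendsto (fun n => lastQuotient f h n z) atTop (𝓝 c) := by
  obtain ⟨N, hN⟩ := eventually_atTop.1 hz
  refine ⟨lastQuotient f h N z, tendsto_const_nhds.congr' ?_⟩
  filter_upwards [eventually_ge_atTop N] with n hn
  induction n, hn using Nat.le_induction with
  | base => rfl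
  | succ n hn ih =>
    rw [lastQuotient_succ_of_eq_zero (hN _ (hn.trans n.le_succ))]; exact ih

variable [MeasurableSpace α] {μ : Measure α}

/-- The Beltrami equation passes to weak limits: if `f n = m n * h n` with `|m n| ≤ 1` and
`m n → m'` almost everywhere, then the weak limits satisfy `f' = m' * h'`. The coefficients
`m n` need not be measurable. -/
lemma IsWeakL2Limit.ae_eq_mul {F : Filter ℕ} [F.NeBot] (hF : F ≤ atTop) {f' h' m' : α → ℂ}
    (hf' : MemLp f' 2 μ) (hh' : MemLp h' 2 μ)
    (hfl : IsWeakL2Limit μ F f f') (hhl : IsWeakL2Limit μ F h h')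
    (hf : ∀ n, MemLp (f n) 2 μ) (hh : ∀ n, MemLp (h n) 2 μ)
    {R : ℝ≥0∞} (hR : R ≠ ⊤) (hb : ∀ n, eLpNorm (h n) 2 μ ≤ R)
    (hfh : ∀ n, ∀ᵐ z ∂μ, f n z = m n z * h n z) (hm : ∀ n, ∀ᵐ z ∂μ, ‖m n z‖ ≤ 1)
    (hlim : ∀ᵐ z ∂μ, Tendsto (fun n => m n z) atTop (𝓝 (m' z))) :
    ∀ᵐ z ∂μ, f' z = m' z * h' z := by
  let f₁ : ℕ → α → ℂ := fun n => ((hf n).1.aemeasurable).mk (f n)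
  let h₁ : ℕ → α → ℂ := fun n => ((hh n).1.aemeasurable).mk (h n)
  have hf₁ : ∀ᵐ z ∂μ, ∀ n, f n z = f₁ n z := ae_all_iff.2 fun n => AEMeasurable.ae_eq_mk _
  have hh₁ : ∀ᵐ z ∂μ, ∀ n, h n z = h₁ n z := ae_all_iff.2 fun n => AEMeasurable.ae_eq_mk _
  have hfm : ∀ n, Measurable (f₁ n) := fun n => AEMeasurable.measurable_mk _
  have hhm : ∀ n, Measurable (h₁ n) := fun n => AEMeasurable.measurable_mk _
  have hfh₁ : ∀ᵐ z ∂μ, ∀ n, f₁ n z = m n z * h₁ n z := by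
    filter_upwards [hf₁, hh₁, ae_all_iff.2 hfh] with z h1 h2 h3 n
    rw [← h1, ← h2, h3]
  -- A measurable replacement for `m n` that satisfies the same equation and converges almost
  -- everywhere. Its limit may differ from `m'` where the `h₁ n` eventually vanish.
  set q := lastQuotient f₁ h₁ with hq
  have hqm : ∀ n, AEStronglyMeasurable (q n) μ := fun n =>
    (measurable_lastQuotient hfm hhm n).aestronglyMeasurable
  have hq1 : ∀ n, ∀ᵐ z ∂μ, ‖q n z‖ ≤ 1 := by
    intro n
    filter_upwards [hfh₁, ae_all_iff.2 hm] with z h1 h2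
    exact norm_lastQuotient_le h1 h2 n
  have hqlim : ∀ᵐ z ∂μ, ∃ c, Tendsto (fun n => q n z) atTop (𝓝 c) := by
    filter_upwards [hfh₁, hlim] with z h1 h2
    by_cases hfr : ∃ᶠ n in atTop, h₁ n z ≠ 0
    · exact ⟨_, tendsto_lastQuotient_of_frequently h1 h2 hfr⟩
    · exact exists_tendsto_lastQuotient (by simpa using hfr)
  obtain ⟨q', -, hq'⟩ := exists_stronglyMeasurable_limit_of_tendsto_ae hqm hqlim
  have hmain := IsWeakL2Limit.mul hF hh' hhl hh hR hb hqm hq1 hq'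
  have e1 : ∀ᵐ z ∂μ, f' z = q' z * h' z := by
    refine IsWeakL2Limit.ae_eq (F := F) hfl (fun g hg => ?_) hf' hmain.1
    refine (hmain.2 g hg).congr fun n => integral_congr_ae ?_
    filter_upwards [hfh₁, hf₁, hh₁] with z h1 h2 h3
    rw [h2, h3, lastQuotient_mul h1]
  have hχm : ∀ n, MeasurableSet {z | ∃ k, n ≤ k ∧ h₁ k z ≠ 0} := fun n => by
    have : {z | ∃ k, n ≤ k ∧ h₁ k z ≠ 0} = ⋃ k, ⋃ (_ : n ≤ k), (h₁ k) ⁻¹' {0}ᶜ := by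
      ext z; simp
    rw [this]
    exact MeasurableSet.iUnion fun k => MeasurableSet.iUnion fun _ =>
      hhm k (measurableSet_singleton 0).compl
  -- Multiplying by `χ n` does not change `h₁ n`, so `h' = χ' h'`. Thus `h'` vanishes almost
  -- everywhere on the set where `h₁ n` is eventually zero, and the discrepancy between `q'` and
  -- `m'` is harmless.
  set χ : ℕ → α → ℂ := fun n => {z | ∃ k, n ≤ k ∧ h₁ k z ≠ 0}.indicator 1 with hχ
  set χ' : α → ℂ := {z | ∃ᶠ n in atTop, h₁ n z ≠ 0}.indicator 1 with hχ'
  have hχlim : ∀ z, Tendsto (fun n => χ n z) atTop (𝓝 (χ' z)) := by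
    intro z
    refine tendsto_const_nhds.congr' ?_
    by_cases hz : ∃ᶠ n in atTop, h₁ n z ≠ 0
    · refine Eventually.of_forall fun n => ?_
      have h1 : ∃ k, n ≤ k ∧ h₁ k z ≠ 0 := frequently_atTop.1 hz n
      simp only [hχ, hχ']
      rw [Set.indicator_of_mem (show z ∈ {z | ∃ k, n ≤ k ∧ h₁ k z ≠ 0} from h1),
        Set.indicator_of_mem (show z ∈ {z | ∃ᶠ n in atTop, h₁ n z ≠ 0} from hz)]
    · obtain ⟨N, hN⟩ := eventually_atTop.1 (not_frequently.1 hz)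
      filter_upwards [eventually_ge_atTop N] with n hn
      have h1 : ¬ ∃ k, n ≤ k ∧ h₁ k z ≠ 0 := fun ⟨k, hk, hk'⟩ => hN k (hn.trans hk) hk'
      simp only [hχ, hχ']
      rw [Set.indicator_of_notMem (show z ∉ {z | ∃ k, n ≤ k ∧ h₁ k z ≠ 0} from h1),
        Set.indicator_of_notMem (show z ∉ {z | ∃ᶠ n in atTop, h₁ n z ≠ 0} from hz)]
  have hχmain := IsWeakL2Limit.mul hF hh' hhl hh hR hb (m := χ) (m' := χ')
    (fun n => (measurable_one.indicator (hχm n)).aestronglyMeasurable)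
    (fun n => ae_of_all _ fun z => by
      simp only [hχ]
      refine (norm_indicator_le_norm_self _ _).trans ?_
      simp) (ae_of_all _ hχlim)
  have e2 : ∀ᵐ z ∂μ, h' z = χ' z * h' z := by
    refine IsWeakL2Limit.ae_eq (F := F) hhl (fun g hg => ?_) hh' hχmain.1
    refine (hχmain.2 g hg).congr fun n => integral_congr_ae ?_
    filter_upwards [hh₁] with z h3
    by_cases h0 : h₁ n z = 0
    · rw [h3, h0]; simp
    · simp only [hχ]
      rw [Set.indicator_of_mem (show z ∈ {z | ∃ k, n ≤ k ∧ h₁ k z ≠ 0} from ⟨n, le_rfl, h0⟩)]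
      simp
  filter_upwards [e1, e2, hfh₁, hlim, hq'] with z h1 h2 h3 h4 h5
  by_cases hz : ∃ᶠ n in atTop, h₁ n z ≠ 0
  · rw [h1, tendsto_nhds_unique h5 (tendsto_lastQuotient_of_frequently h3 h4 hz)]
  · have : h' z = 0 := by
      rw [h2]; simp only [hχ']
      rw [Set.indicator_of_notMem (show z ∉ {z | ∃ᶠ n in atTop, h₁ n z ≠ 0} from hz), zero_mul]
    rw [h1, this, mul_zero, mul_zero]

end BeltramiLimits

/-! ### Existence of the limit derivative -/

section LimitDerivative

variable {U : Set ℂ}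

lemma IsOpen.exists_compact_exhaustion (hU : IsOpen U) : ∃ C : ℕ → Set ℂ,
    (∀ j, IsCompact (C j)) ∧ (∀ j, C j ⊆ U) ∧ (⋃ j, C j) = U ∧
      ∀ S, IsCompact S → S ⊆ U → ∃ j, S ⊆ C j := by
  have : LocallyCompactSpace U := hU.locallyCompactSpace
  let E : CompactExhaustion U := CompactExhaustion.choice U
  refine ⟨fun j => Subtype.val '' E j, fun j => (E.isCompact j).image continuous_subtype_val,
    fun j => Subtype.coe_image_subset U (E j), ?_, fun S hS hSU => ?_⟩
  · rw [← Set.image_iUnion, E.iUnion_eq, Set.image_univ, Subtype.range_coe]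
  · obtain ⟨j, hj⟩ := E.exists_superset_of_isCompact
      (Topology.IsEmbedding.subtypeVal.isCompact_preimage_iff
        (by rwa [Subtype.range_coe]) |>.2 hS : IsCompact (Subtype.val ⁻¹' S : Set U))
    exact ⟨j, fun z hz => ⟨⟨z, hSU hz⟩, hj hz, rfl⟩⟩

/-- A sequence of fields that is bounded in `L²` on each compact subset of `U` is bounded in `L²`
after multiplication with a suitable positive weight. -/
lemma exists_weight {E : Type*} [NormedAddCommGroup E] [NormedSpace ℝ E] (hU : IsOpen U)
    {G : ℕ → ℂ → E} (hG : ∀ n C, IsCompact C → C ⊆ U → MemLp (G n) 2 (volume.restrict C))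
    (hB : ∀ C, IsCompact C → C ⊆ U → ∃ B : ℝ, 0 ≤ B ∧
      ∀ n, ∫⁻ z in C, ‖G n z‖ₑ ^ 2 ≤ ENNReal.ofReal B) :
    ∃ w : ℂ → ℝ, Measurable w ∧ (∀ z, 0 ≤ w z) ∧ (∀ z ∉ U, w z = 0) ∧
      (∀ C, IsCompact C → C ⊆ U → ∃ c > 0, ∀ z ∈ C, c ≤ w z) ∧
      ∀ n, MemLp (fun z => w z • G n z) 2 volume ∧ eLpNorm (fun z => w z • G n z) 2 volume ≤ 2 := by
  obtain ⟨C, hC, hCU, hCun, hCex⟩ := hU.exists_compact_exhaustion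
  choose B hB0 hBle using fun j => hB (C j) (hC j) (hCU j)
  -- The factor `1 / (1 + B j)` offsets the energy on `C j`, and the geometric factor makes the sum
  -- of weighted energies at most `2`. The weight is the square root of the resulting density `ρ`.
  set c : ℕ → ℝ := fun j => (1 / 2) ^ j / (1 + B j) with hc
  have hcpos : ∀ j, 0 < c j := fun j => div_pos (by positivity) (by linarith [hB0 j])
  have hcle : ∀ j, c j ≤ (1 / 2) ^ j := fun j =>
    div_le_self (by positivity) (by linarith [hB0 j])
  have hcB : ∀ j, c j * B j ≤ (1 / 2) ^ j := fun j => by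
    rw [hc]
    simp only
    rw [div_mul_eq_mul_div, div_le_iff₀ (by linarith [hB0 j])]
    have : (0 : ℝ) < (1 / 2) ^ j := by positivity
    nlinarith
  have hsum : ∑' j : ℕ, ENNReal.ofReal ((1 / 2) ^ j) = 2 := by
    rw [← ENNReal.ofReal_tsum_of_nonneg (fun j => by positivity) summable_geometric_two,
      tsum_geometric_two]
    simp
  set ρ : ℂ → ℝ≥0∞ := fun z => ∑' j, (C j).indicator (fun _ => ENNReal.ofReal (c j)) z with hρ
  have hρm : Measurable ρ := Measurable.tsum fun j =>
    measurable_const.indicator (hC j).measurableSet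
  have hρle : ∀ z, ρ z ≤ 2 := fun z => by
    rw [← hsum]
    exact ENNReal.tsum_le_tsum fun j => (Set.indicator_le_self _ _ _).trans
      (ENNReal.ofReal_le_ofReal (hcle j))
  have hρfin : ∀ z, ρ z ≠ ⊤ := fun z => ((hρle z).trans_lt (by simp)).ne
  have hwsq : ∀ z, ‖√(ρ z).toReal‖ₑ ^ 2 = ρ z := fun z => by
    rw [Real.enorm_eq_ofReal (Real.sqrt_nonneg _), ← ENNReal.ofReal_pow (Real.sqrt_nonneg _),
      Real.sq_sqrt ENNReal.toReal_nonneg, ENNReal.ofReal_toReal (hρfin z)]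
  have hw0 : ∀ z ∉ U, √(ρ z).toReal = 0 := fun z hz => by
    have : ρ z = 0 := by
      rw [hρ]
      simp only [ENNReal.tsum_eq_zero]
      exact fun j => Set.indicator_of_notMem (fun h => hz (hCU j h)) _
    simp [this]
  refine ⟨fun z => √(ρ z).toReal, hρm.ennreal_toReal.sqrt, fun z => Real.sqrt_nonneg _, hw0,
    fun S hS hSU => ?_, fun n => ?_⟩
  · obtain ⟨j, hj⟩ := hCex S hS hSU
    refine ⟨√(c j), Real.sqrt_pos.2 (hcpos j), fun z hz => Real.sqrt_le_sqrt ?_⟩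
    have h1 : ENNReal.ofReal (c j) ≤ ρ z := by
      refine le_trans (le_of_eq ?_) (ENNReal.le_tsum j)
      rw [Set.indicator_of_mem (hj hz)]
    exact (ENNReal.ofReal_le_iff_le_toReal (hρfin z)).1 h1
  · have hGm : AEStronglyMeasurable (G n) (volume.restrict U) := by
      rw [← hCun, aestronglyMeasurable_iUnion_iff]
      exact fun j => (hG n _ (hC j) (hCU j)).1
    have hm : AEStronglyMeasurable (fun z => √(ρ z).toReal • G n z) volume := by
      have h1 : AEStronglyMeasurable (U.indicator (G n)) volume :=
        (aestronglyMeasurable_indicator_iff hU.measurableSet).2 hGm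
      refine (hρm.ennreal_toReal.sqrt.aestronglyMeasurable.smul h1).congr
        (ae_of_all _ fun z => ?_)
      by_cases hz : z ∈ U
      · simp [hz]
      · simp [hw0 z hz]
    have hle : ∫⁻ z, ‖√(ρ z).toReal • G n z‖ₑ ^ 2 ≤ 2 := by
      calc ∫⁻ z, ‖√(ρ z).toReal • G n z‖ₑ ^ 2
          = ∫⁻ z, ∑' j, (C j).indicator (fun z => ENNReal.ofReal (c j) * ‖G n z‖ₑ ^ 2) z := by
            congr 1 with z
            rw [enorm_smul, mul_pow, hwsq, hρ, ← ENNReal.tsum_mul_right]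
            congr 1 with j
            by_cases hz : z ∈ C j <;> simp [hz]
        _ = ∑' j, ∫⁻ z in C j, ENNReal.ofReal (c j) * ‖G n z‖ₑ ^ 2 := by
            rw [lintegral_tsum]
            · congr 1 with j
              rw [lintegral_indicator (hC j).measurableSet]
            · intro j
              rw [aemeasurable_indicator_iff (hC j).measurableSet]
              exact ((hG n _ (hC j) (hCU j)).1.enorm.pow_const 2).const_mul _
        _ ≤ ∑' j : ℕ, ENNReal.ofReal ((1 / 2) ^ j) := by
            refine ENNReal.tsum_le_tsum fun j => ?_
            rw [lintegral_const_mul' _ _ ENNReal.ofReal_ne_top]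
            refine (mul_le_mul_right (hBle j n) _).trans ?_
            rw [← ENNReal.ofReal_mul (hcpos j).le]
            exact ENNReal.ofReal_le_ofReal (hcB j)
        _ = 2 := hsum
    have hL : eLpNorm (fun z => √(ρ z).toReal • G n z) 2 volume ≤ 2 := by
      rw [eLpNorm_eq_lintegral_rpow_enorm_toReal two_ne_zero ENNReal.ofNat_ne_top]
      simp only [ENNReal.toReal_ofNat, ENNReal.rpow_ofNat]
      refine (ENNReal.rpow_le_rpow hle (by norm_num)).trans ?_
      refine (ENNReal.rpow_le_rpow_of_exponent_le one_le_two (by norm_num : (1 / 2 : ℝ) ≤ 1)).trans ?_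
      rw [ENNReal.rpow_one]
    exact ⟨⟨hm, hL.trans_lt (by simp)⟩, hL⟩

lemma tendsto_integral_of_tendstoUniformlyOn {Φ : ℕ → ℂ → ℂ} {Φ' : ℂ → ℂ}
    (hΦ : ∀ n, ContinuousOn (Φ n) U) (hΦ' : ContinuousOn Φ' U)
    (hconv : ∀ C : Set ℂ, IsCompact C → C ⊆ U → TendstoUniformlyOn Φ Φ' atTop C)
    {f : ℂ → ℝ} (hf : Continuous f) (hfc : HasCompactSupport f) (hfU : tsupport f ⊆ U) :
    Tendsto (fun n => ∫ z, f z • Φ n z) atTop (𝓝 (∫ z, f z • Φ' z)) := by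
  have hi : ∀ {Ψ : ℂ → ℂ}, ContinuousOn Ψ U → Integrable (fun z => f z • Ψ z) := fun hΨ =>
    integrable_smul_of_hasCompactSupport hf hfc
      (memLp_two_of_continuousOn hfc.isCompact (hΨ.mono hfU))
  have hI : 0 ≤ ∫ z, |f z| := integral_nonneg fun z => abs_nonneg _
  have hfi : Integrable fun z => |f z| := (hf.integrable_of_hasCompactSupport hfc).norm
  rw [Metric.tendsto_atTop]
  intro ε hε
  have hδ : 0 < ε / ((∫ z, |f z|) + 1) := by positivity
  obtain ⟨N, hN⟩ := eventually_atTop.1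
    (Metric.tendstoUniformlyOn_iff.1 (hconv _ hfc.isCompact hfU) _ hδ)
  refine ⟨N, fun n hn => ?_⟩
  rw [dist_eq_norm, ← integral_sub (hi (hΦ n)) (hi hΦ')]
  have hb : ∀ z, ‖f z • Φ n z - f z • Φ' z‖ ≤ |f z| * (ε / ((∫ z, |f z|) + 1)) := by
    intro z
    rw [← smul_sub, norm_smul, Real.norm_eq_abs]
    by_cases hz : z ∈ tsupport f
    · have := (hN n hn z hz).le
      rw [dist_comm, dist_eq_norm] at this
      gcongr
    · simp [image_eq_zero_of_notMem_tsupport hz]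
  calc _ ≤ ∫ z, |f z| * (ε / ((∫ z, |f z|) + 1)) :=
        norm_integral_le_of_norm_le (hfi.mul_const _) (ae_of_all _ hb)
    _ = (∫ z, |f z|) * (ε / ((∫ z, |f z|) + 1)) := integral_mul_const _ _
    _ < ε := by
        rw [mul_div_assoc', div_lt_iff₀ (by positivity)]
        nlinarith

/-- A locally uniform limit of maps whose derivatives are locally bounded in `L²` has local `L²`
derivatives, and Beltrami equations with almost everywhere convergent coefficients pass to the
limit. -/
lemma exists_hasLocalL2Deriv_limit (hU : IsOpen U) {Φ : ℕ → ℂ → ℂ} {Φ' : ℂ → ℂ}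
    (hΦ : ∀ n, ContinuousOn (Φ n) U) (hΦ' : ContinuousOn Φ' U)
    (hconv : ∀ C : Set ℂ, IsCompact C → C ⊆ U → TendstoUniformlyOn Φ Φ' atTop C)
    {G : ℕ → ℂ → ℂ →L[ℝ] ℂ} (hG : ∀ n, HasLocalL2Deriv U (Φ n) (G n))
    (hB : ∀ C, IsCompact C → C ⊆ U → ∃ B : ℝ, 0 ≤ B ∧
      ∀ n, ∫⁻ z in C, ‖G n z‖ₑ ^ 2 ≤ ENNReal.ofReal B) :
    ∃ G' : ℂ → ℂ →L[ℝ] ℂ, HasLocalL2Deriv U Φ' G' ∧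
      (∀ (m : ℕ → ℂ → ℂ) (m' : ℂ → ℂ),
        (∀ n, ∀ᵐ z ∂(volume.restrict U),
          wirtingerBar (G n z) = m n z * wirtinger (G n z)) →
        (∀ n, ∀ᵐ z ∂(volume.restrict U), ‖m n z‖ ≤ 1) →
        (∀ᵐ z ∂(volume.restrict U), Tendsto (fun n => m n z) atTop (𝓝 (m' z))) →
        ∀ᵐ z ∂(volume.restrict U), wirtingerBar (G' z) = m' z * wirtinger (G' z)) ∧
      ((∀ n, ∀ᵐ z ∂(volume.restrict U), wirtinger (G n z) = 0) →
        ∀ᵐ z ∂(volume.restrict U), wirtinger (G' z) = 0) := by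
  obtain ⟨w, hwm, hw0, hwU, hwc, hwG⟩ := exists_weight hU (fun n => (hG n).1) hB
  have hwpos : ∀ z ∈ U, 0 < w z := fun z hz => by
    obtain ⟨c, hc, hcw⟩ := hwc {z} isCompact_singleton (Set.singleton_subset_iff.2 hz)
    exact hc.trans_le (hcw z rfl)
  have hcomp : ∀ {T : (ℂ →L[ℝ] ℂ) → ℂ}, Continuous T → (∀ A, ‖T A‖ ≤ ‖A‖) →
      (∀ (r : ℝ) A, T (r • A) = r * T A) → ∀ n,
      MemLp (fun z => (w z : ℂ) * T (G n z)) 2 volume ∧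
        eLpNorm (fun z => (w z : ℂ) * T (G n z)) 2 volume ≤ 2 := by
    intro T hT hTn hTs n
    have e : (fun z => (w z : ℂ) * T (G n z)) = fun z => T (w z • G n z) := by
      ext z; rw [hTs]
    rw [e]
    have hle : ∀ z, ‖T (w z • G n z)‖ ≤ ‖w z • G n z‖ := fun z => hTn _
    exact ⟨(hwG n).1.mono (hT.comp_aestronglyMeasurable (hwG n).1.1) (ae_of_all _ hle),
      (eLpNorm_mono hle).trans (hwG n).2⟩
  have hs1 : ∀ (r : ℝ) (A : ℂ →L[ℝ] ℂ), wirtinger (r • A) = r * wirtinger A := fun r A => by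
    simp [wirtinger]; ring
  have hs2 : ∀ (r : ℝ) (A : ℂ →L[ℝ] ℂ), wirtingerBar (r • A) = r * wirtingerBar A := fun r A => by
    simp [wirtingerBar]; ring
  have ha := hcomp continuous_wirtinger norm_wirtinger_le hs1
  have hb := hcomp continuous_wirtingerBar norm_wirtingerBar_le hs2
  -- A single nonprincipal ultrafilter serves both coefficients and all compact sets; it refines
  -- `atTop`, so ordinary limits survive along it.
  set F : Ultrafilter ℕ := hyperfilter ℕ with hFdef
  have hF : (F : Filter ℕ) ≤ atTop := Nat.hyperfilter_le_atTop
  obtain ⟨A, hA, hAlim⟩ := exists_isWeakL2Limit F (fun n => (ha n).1) (R := 2) (by simp)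
    fun n => (ha n).2
  obtain ⟨B, hBL, hBlim⟩ := exists_isWeakL2Limit F (fun n => (hb n).1) (R := 2) (by simp)
    fun n => (hb n).2
  have hinv : ∀ {D : ℂ → ℂ}, MemLp D 2 volume → ∀ C, IsCompact C → C ⊆ U →
      MemLp (fun z => ((w z)⁻¹ : ℂ) * D z) 2 (volume.restrict C) := by
    intro D hD C hC hCU
    obtain ⟨c, hc, hcw⟩ := hwc C hC hCU
    refine MemLp.of_le_mul (c := c⁻¹) (hD.restrict C) ?_ ?_
    · exact (Complex.measurable_ofReal.comp hwm).inv.aestronglyMeasurable.mul (hD.restrict C).1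
    · refine (ae_restrict_iff' hC.measurableSet).2 (ae_of_all _ fun z hz => ?_)
      rw [norm_mul, norm_inv, Complex.norm_real, Real.norm_of_nonneg (hw0 z)]
      gcongr
      exact hcw z hz
  set G' : ℂ → ℂ →L[ℝ] ℂ := fun z =>
    ofWirtinger (((w z)⁻¹ : ℂ) * A z) (((w z)⁻¹ : ℂ) * B z) with hG'
  have htest : ∀ {D : ℂ → ℂ} {T : (ℂ →L[ℝ] ℂ) → ℂ},
      IsWeakL2Limit volume F (fun n z => (w z : ℂ) * T (G n z)) D →
      ∀ φ : ℂ → ℝ, Continuous φ → HasCompactSupport φ → tsupport φ ⊆ U →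
      Tendsto (fun n => ∫ z, (φ z : ℂ) * T (G n z)) F
        (𝓝 (∫ z, (φ z : ℂ) * (((w z)⁻¹ : ℂ) * D z))) := by
    intro D T hD φ hφ hφc hφU
    obtain ⟨c, hc, hcw⟩ := hwc _ hφc.isCompact hφU
    -- Dividing the test function by `w` keeps it in `L²`, since `w` is bounded below on its
    -- support; this undoes the weight in the pairing.
    have hg : MemLp (fun z => ((w z)⁻¹ : ℂ) * φ z) 2 volume := by
      refine MemLp.of_le_mul (c := c⁻¹) (hφ.memLp_of_hasCompactSupport (p := 2) hφc) ?_ ?_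
      · exact (Complex.measurable_ofReal.comp hwm).inv.aestronglyMeasurable.mul
          (Complex.continuous_ofReal.comp hφ).aestronglyMeasurable
      · refine ae_of_all _ fun z => ?_
        rw [norm_mul, norm_inv, Complex.norm_real, Complex.norm_real,
          Real.norm_of_nonneg (hw0 z)]
        by_cases hz : z ∈ tsupport φ
        · gcongr
          exact hcw z hz
        · simp [image_eq_zero_of_notMem_tsupport hz]
    have e1 : ∫ z, ((w z)⁻¹ : ℂ) * φ z * D z = ∫ z, (φ z : ℂ) * (((w z)⁻¹ : ℂ) * D z) := by
      congr 1 with z; ring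
    rw [← e1]
    refine (hD _ hg).congr fun n => ?_
    congr 1 with z
    by_cases hz : z ∈ U
    · have : (w z : ℂ) ≠ 0 := Complex.ofReal_ne_zero.2 (hwpos z hz).ne'
      field_simp
    · simp [image_eq_zero_of_notMem_tsupport fun h => hz (hφU h)]
  have hGL : ∀ C, IsCompact C → C ⊆ U → MemLp G' 2 (volume.restrict C) := by
    intro C hC hCU
    have h1 := hinv hA C hC hCU
    have h2 := hinv hBL C hC hCU
    refine (h1.norm.add h2.norm).mono ?_ (ae_of_all _ fun z => ?_)
    · exact (h1.1.smul aestronglyMeasurable_const).add (h2.1.smul aestronglyMeasurable_const)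
    · refine (norm_le_wirtinger _).trans (le_of_eq ?_)
      simp only [hG', wirtinger_ofWirtinger, wirtingerBar_ofWirtinger, Pi.add_apply]
      rw [Real.norm_of_nonneg (by positivity)]
  have hsplit : ∀ {H : ℂ → ℂ →L[ℝ] ℂ},
      (∀ C, IsCompact C → C ⊆ U → MemLp H 2 (volume.restrict C)) →
      ∀ φ : ℂ → ℝ, Continuous φ → HasCompactSupport φ → tsupport φ ⊆ U → ∀ v : ℂ,
      ∫ z, φ z • H z v = (∫ z, (φ z : ℂ) * wirtinger (H z)) * v +
        (∫ z, (φ z : ℂ) * wirtingerBar (H z)) * (starRingEnd ℂ) v := by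
    intro H hH φ hφ hφc hφU v
    have hm := hH _ hφc.isCompact hφU
    have i1 : Integrable (fun z => (φ z : ℂ) * wirtinger (H z)) :=
      integrable_smul_of_hasCompactSupport hφ hφc
        (hm.mono (continuous_wirtinger.comp_aestronglyMeasurable hm.1)
          (ae_of_all _ fun z => norm_wirtinger_le _))
    have i2 : Integrable (fun z => (φ z : ℂ) * wirtingerBar (H z)) :=
      integrable_smul_of_hasCompactSupport hφ hφc
        (hm.mono (continuous_wirtingerBar.comp_aestronglyMeasurable hm.1)
          (ae_of_all _ fun z => norm_wirtingerBar_le _))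
    rw [← integral_mul_const, ← integral_mul_const,
      ← integral_add (i1.mul_const _) (i2.mul_const _)]
    congr 1 with z
    rw [apply_eq_wirtinger (H z) v, Complex.real_smul]
    ring
  have hae : ∀ {P : ℂ → Prop}, (∀ᵐ z ∂(volume.restrict U), P z) ↔ ∀ᵐ z, z ∈ U → P z :=
    ae_restrict_iff' hU.measurableSet
  refine ⟨G', ⟨hGL, fun φ hφ hφc hφU v => ?_⟩, fun m m' hm hm1 hlim => ?_, fun h0 => ?_⟩
  · have h1 := (tendsto_integral_of_tendstoUniformlyOn hΦ hΦ' hconv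
      ((hφ.continuous_fderiv (by simp)).clm_apply continuous_const) (hφc.fderiv_apply ℝ v)
      ((tsupport_fderiv_apply_subset ℝ v).trans hφU)).mono_left hF
    have h2 := (((htest hAlim φ hφ.continuous hφc hφU).mul_const v).add
      ((htest hBlim φ hφ.continuous hφc hφU).mul_const ((starRingEnd ℂ) v))).neg
    refine tendsto_nhds_unique (h1.congr fun n => ?_) h2 |>.trans ?_
    · rw [(hG n).2 φ hφ hφc hφU v, hsplit (hG n).1 φ hφ.continuous hφc hφU v]
    · rw [hsplit hGL φ hφ.continuous hφc hφU v]
      simp [hG']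
  -- Extending the coefficients by zero makes the hypotheses hold on the whole plane: outside `U`
  -- the weight vanishes and the equation is trivial.
  · have key := IsWeakL2Limit.ae_eq_mul (m := fun n => U.indicator (m n))
      (m' := U.indicator m') hF hBL hA hBlim hAlim (fun n => (hb n).1) (fun n => (ha n).1)
      (R := 2) (by simp) (fun n => (ha n).2) (fun n => ?_) (fun n => ?_) ?_
    · rw [hae]
      filter_upwards [key] with z hz hzU
      simp only [hG', wirtinger_ofWirtinger, wirtingerBar_ofWirtinger, hz,
        Set.indicator_of_mem hzU]
      ring
    · filter_upwards [hae.1 (hm n)] with z hz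
      by_cases hzU : z ∈ U
      · rw [hz hzU, Set.indicator_of_mem hzU]; ring
      · simp [hwU z hzU]
    · filter_upwards [hae.1 (hm1 n)] with z hz
      by_cases hzU : z ∈ U
      · simpa [hzU] using hz hzU
      · simp [hzU]
    · filter_upwards [hae.1 hlim] with z hz
      by_cases hzU : z ∈ U
      · simpa [hzU] using hz hzU
      · simp [hzU]
  -- The same principle applied to `a = 0 · a`.
  · have key := IsWeakL2Limit.ae_eq_mul (m := 0) (m' := 0) hF hA hA hAlim hAlim
      (fun n => (ha n).1) (fun n => (ha n).1) (R := 2) (by simp) (fun n => (ha n).2)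
      (fun n => ?_) (by simp) (by simp)
    · rw [hae]
      filter_upwards [key] with z hz _
      rw [Pi.zero_apply, zero_mul] at hz
      simp only [hG', wirtinger_ofWirtinger, hz, mul_zero]
    · filter_upwards [hae.1 (h0 n)] with z hz
      by_cases hzU : z ∈ U
      · rw [hz hzU, mul_zero, mul_zero]
      · rw [hwU z hzU, Complex.ofReal_zero, zero_mul, mul_zero]

end LimitDerivative

/-! ### Uniqueness of the derivative and the conclusion -/

lemma IsHomeoOnto.continuousOn {U : Set ℂ} {Φ : ℂ → ℂ} (h : IsHomeoOnto U Φ) :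
    ContinuousOn Φ U :=
  continuousOn_iff_continuous_domRestrict.2 h.continuous

/-- The derivative in the sense of distributions is unique almost everywhere. -/
lemma HasLocalL2Deriv.ae_eq {U : Set ℂ} (hU : IsOpen U) {Φ : ℂ → ℂ} {G H : ℂ → ℂ →L[ℝ] ℂ}
    (hG : HasLocalL2Deriv U Φ G) (hH : HasLocalL2Deriv U Φ H) :
    ∀ᵐ z ∂(volume.restrict U), G z = H z := by
  have key : ∀ v, ∀ᵐ z, z ∈ U → G z v - H z v = 0 := by
    intro v
    have hloc : ∀ {A : ℂ → ℂ →L[ℝ] ℂ}, HasLocalL2Deriv U Φ A →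
        LocallyIntegrableOn (fun z => A z v) U volume := by
      intro A hA
      rw [locallyIntegrableOn_iff hU.isLocallyClosed]
      intro C hCU hC
      have : IsFiniteMeasure (volume.restrict C) := ⟨by simpa using hC.measure_lt_top⟩
      exact (memLp_two_apply (hA.1 C hC hCU) v).integrable one_le_two
    refine hU.ae_eq_zero_of_integral_contDiff_smul_eq_zero ((hloc hG).sub (hloc hH))
      fun φ hφ hφc hφU => ?_
    have hi : ∀ {A : ℂ → ℂ →L[ℝ] ℂ}, HasLocalL2Deriv U Φ A →
        Integrable (fun z => φ z • A z v) := fun hA =>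
      integrable_smul_of_hasCompactSupport hφ.continuous hφc
        (memLp_two_apply (hA.1 _ hφc.isCompact hφU) v)
    have h1 := hG.2 φ hφ hφc hφU v
    have h2 := hH.2 φ hφ hφc hφU v
    simp_rw [smul_sub]
    rw [integral_sub (hi hG) (hi hH), sub_eq_zero]
    exact neg_injective (h1.symm.trans h2)
  rw [ae_restrict_iff' hU.measurableSet]
  filter_upwards [key 1, key Complex.I] with z h1 h2 hz
  have e1 := sub_eq_zero.1 (h1 hz)
  have e2 := sub_eq_zero.1 (h2 hz)
  rw [← ofWirtinger_wirtinger (G z), ← ofWirtinger_wirtinger (H z)]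
  simp only [wirtinger, wirtingerBar, e1, e2]

lemma exists_bound_of_tendstoUniformlyOn {U : Set ℂ} {Φ : ℕ → ℂ → ℂ} {Φ' : ℂ → ℂ}
    (hΦ : ∀ n, ContinuousOn (Φ n) U) (hΦ' : ContinuousOn Φ' U) {S : Set ℂ} (hS : IsCompact S)
    (hSU : S ⊆ U) (h : TendstoUniformlyOn Φ Φ' atTop S) : ∃ M, ∀ n, ∀ z ∈ S, ‖Φ n z‖ ≤ M := by
  obtain ⟨M', hM'⟩ := hS.exists_bound_of_continuousOn (hΦ'.mono hSU)
  choose M hM using fun n => hS.exists_bound_of_continuousOn ((hΦ n).mono hSU)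
  obtain ⟨N, hN⟩ := eventually_atTop.1 (Metric.tendstoUniformlyOn_iff.1 h 1 one_pos)
  refine ⟨max (M' + 1) (∑ i ∈ Finset.range N, |M i|), fun n z hz => ?_⟩
  rcases le_or_gt N n with hn | hn
  · refine le_max_of_le_left ?_
    have h1 := hN n hn z hz
    rw [dist_comm, dist_eq_norm] at h1
    have h2 := hM' z hz
    have h3 := norm_le_norm_add_norm_sub' (Φ n z) (Φ' z)
    linarith
  · refine le_max_of_le_right (((hM n z hz).trans (le_abs_self _)).trans ?_)
    exact Finset.single_le_sum (f := fun i => |M i|) (fun i _ => abs_nonneg _)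
      (Finset.mem_range.2 hn)

theorem mainTheorem8 (K : ℝ) (hK : 0 < K) (U : Set ℂ) (hUo : IsOpen U) (hUc : IsConnected U)
    (Φseq : ℕ → ℂ → ℂ) (Φ : ℂ → ℂ)
    (hΦseq : ∀ n, IsKHomeo K U (Φseq n))
    (hΦ : IsHomeoOnto U Φ)
    (hconv : ∀ C : Set ℂ, IsCompact C → C ⊆ U → TendstoUniformlyOn Φseq Φ atTop C)
    (σseq : ℕ → AlmostComplexStructure) (σ : AlmostComplexStructure)
    (hσseq : ∀ n, SendsToStandard U (Φseq n) (σseq n))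
    (hσ : ∀ᵐ z ∂(volume.restrict U),
      Tendsto (fun n => (σseq n z).J) atTop (𝓝 (σ z).J)) :
    IsKHomeo K U Φ ∧ SendsToStandard U Φ σ := by
  have hcs : ∀ n, ContinuousOn (Φseq n) U := fun n => (hΦseq n).1.continuousOn
  have hc := hΦ.continuousOn
  choose G hG hGK using fun n => (hΦseq n).2
  have hdil : ∀ n, ∀ᵐ z ∂(volume.restrict U), ‖wirtinger (G n z)‖ + ‖wirtingerBar (G n z)‖ ≤
      K * (‖wirtinger (G n z)‖ - ‖wirtingerBar (G n z)‖) := fun n =>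
    (hGK n).mono fun z hz => add_le_mul_sub_of_dilatation_le hK hz
  have hbel : ∀ n, ∀ᵐ z ∂(volume.restrict U),
      wirtingerBar (G n z) = (σseq n z).beltrami * wirtinger (G n z) := by
    intro n
    -- The two hypotheses on `Φseq n` supply separate derivatives; uniqueness identifies them, so
    -- both conditions hold for `G n`.
    obtain ⟨H, hH, hHσ⟩ := hσseq n
    filter_upwards [(hG n).ae_eq hUo hH, hHσ] with z h1 h2
    rw [h1]
    exact ((σseq n z).comp_eq_I_mul_iff (H z)).1 h2
  have hlim : ∀ᵐ z ∂(volume.restrict U),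
      Tendsto (fun n => (σseq n z).beltrami) atTop (𝓝 (σ z).beltrami) :=
    hσ.mono fun z hz => tendsto_beltrami hz
  obtain ⟨G', hG', hbelG, hzeroG⟩ := exists_hasLocalL2Deriv_limit hUo hcs hc hconv hG
    fun C hC hCU => exists_lintegral_enorm_sq_le hUo hC hCU hK.le hG hcs
      (fun S hS hSU => exists_bound_of_tendstoUniformlyOn hcs hc hS hSU (hconv S hS hSU))
      fun n => (hdil n).mono fun z hz => sq_norm_le_mul_det hz
  have hbel' := hbelG (fun n z => (σseq n z).beltrami) (fun z => (σ z).beltrami) hbel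
    (fun n => ae_of_all _ fun z => (σseq n z).norm_beltrami_lt_one.le) hlim
  have hdil' : ∀ᵐ z ∂(volume.restrict U), ‖wirtinger (G' z)‖ + ‖wirtingerBar (G' z)‖ ≤
      K * (‖wirtinger (G' z)‖ - ‖wirtingerBar (G' z)‖) := by
    -- For `K < 1` the inequality reads `(1 - K)|a| + (1 + K)|b| ≤ 0`, which forces the derivative
    -- to vanish almost everywhere.
    rcases lt_or_ge K 1 with hK1 | hK1
    · have h0 := hzeroG fun n => (hdil n).mono fun z hz => by
        have h1 := norm_nonneg (wirtinger (G n z))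
        have h2 := norm_nonneg (wirtingerBar (G n z))
        exact norm_eq_zero.1 (by nlinarith)
      filter_upwards [h0, hbel'] with z h1 h2
      simp [h2, h1]
    · have hk0 : 0 ≤ (K - 1) / (K + 1) := div_nonneg (by linarith) (by linarith)
      have hk1 : (K - 1) / (K + 1) ≤ 1 := (div_le_one (by linarith)).2 (by linarith)
      -- For `K ≥ 1` the distortion inequality is equivalent to `|b| ≤ (K - 1)/(K + 1) |a|`.
      -- Clipping at this radius preserves the equations and survives in the limit, which yields the
      -- same bound for `G'`.
      have h1 := hbelG (fun n z => radialClip ((K - 1) / (K + 1)) (σseq n z).beltrami)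
        (fun z => radialClip ((K - 1) / (K + 1)) (σ z).beltrami)
        (fun n => by
          filter_upwards [hbel n, hdil n] with z h1 h2
          rw [radialClip_mul_eq, h1]
          rw [← h1, div_mul_eq_mul_div, le_div_iff₀ (by linarith)]
          linarith)
        (fun n => ae_of_all _ fun z => (norm_radialClip_le hk0 _).trans hk1)
        (hlim.mono fun z hz => ((continuous_radialClip hk0).tendsto _).comp hz)
      filter_upwards [h1] with z hz
      have h2 : ‖wirtingerBar (G' z)‖ ≤ (K - 1) / (K + 1) * ‖wirtinger (G' z)‖ := by
        rw [hz, norm_mul]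
        gcongr
        exact norm_radialClip_le hk0 _
      rw [div_mul_eq_mul_div, le_div_iff₀ (by linarith)] at h2
      linarith
  refine ⟨⟨hΦ, G', hG', ?_⟩, G', hG', ?_⟩
  · filter_upwards [hdil', hbel'] with z h1 h2 h3
    refine det_pos_and_dilatation_le ?_ h1
    have h4 : wirtinger (G' z) ≠ 0 := fun h4 => h3 <| by
      rw [← ofWirtinger_wirtinger (G' z), h2, h4]
      ext v
      simp
    rw [h2, norm_mul]
    exact mul_lt_of_lt_one_left (norm_pos_iff.2 h4) (σ z).norm_beltrami_lt_one
  · filter_upwards [hbel'] with z hz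
    exact ((σ z).comp_eq_I_mul_iff (G' z)).2 hz
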